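/- Let $u_0\in C^2([0,1])$ be real-valued with $u_0(0)=0$, and let $j:[0,\infty)\to\mathbb R$ have a piecewise continuous derivative: on every bounded interval $(0,T)$, $j$ is continuously differentiable off a finite set, and $j'$ has finite one-sided limits at every point (corners and jumps of $j$ at the exceptional points are allowed). No compatibility between $u_0$ and $j$ is assumed at $x=1$, that is, $u_0'(1)-u_0(1)$ need not equal $j(0)$. Put $$\hat u_0(\lambda)=\int_0^1 e^{\lambda x}u_0(x)\,dx,\qquad \hat j(\lambda,t)=\int_0^t e^{\lambda s}j(s)\,ds,\qquad \Delta(\lambda)=e^{-i\lambda}(1+i\lambda)-e^{i\lambda}(1-i\lambda),$$ $$\mu_0(\lambda)=(i\lambda+1)e^{-i\lambda}\hat u_0(i\lambda)+(i\lambda-1)e^{i\lambda}\hat u_0(-i\lambda)+2i\lambda\,\hat j(\lambda^2,t),\qquad \mu_1(\lambda)=\mu_0(\lambda)-\Delta(\lambda)\hat u_0(-i\lambda),$$ and, for $\varepsilon>0$, $D_+=\{w+i\varepsilon:\ \tfrac{\pi}{4}\le\arg w\le\tfrac{3\pi}{4}\}$ and $D_-=\{w-i\varepsilon:\ \tfrac{5\pi}{4}\le\arg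 w\le\tfrac{7\pi}{4}\}$, with boundaries oriented so that the sector lies on the left. Consider the integral representation $$u(x,t)=\frac1{2\pi}\left\{\int_{-\infty}^{\infty}e^{i\lambda x-\lambda^2t}\,\hat u_0(-i\lambda)\,d\lambda-\int_{\partial D_+}\frac{e^{i\lambda x-\lambda^2t}}{\Delta(\lambda)}\,\mu_0(\lambda)\,d\lambda-\int_{\partial D_-}\frac{e^{i\lambda x-\lambda^2t}}{\Delta(\lambda)}\,\mu_1(\lambda)\,d\lambda\right\}$$ of the solution of $\partial_tu=\partial_x^2u$ $(0<x<1,\ t>0)$, $u(x,0)=u_0(x)$, $u(0,t)=0$, $(\partial_xu-u)(1,t)=j(t)$. Then for all $0<x<1$ and $t>0$ the three integrals converge absolutely, and the right-hand side has the same value $u(x,t)$, for every $\varepsilon>0$ with $2\varepsilon t<\min(x,1-x)$; for each $t>0$ the function $u(\cdot,t)$ extends continuously to $[0,1]$; and, with this extension, $$\lim_{t\downarrow0}\ \sup_{0\le x\le1}|u(x,t)-u_0(x)|=0 .$$ In particular $u(1,t)\to u_0(1)$ at the boundary $x=1$. -/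

import Mathlib

open Set Filter Topology MeasureTheory

noncomputable section

namespace SingleParticle

/-- `j`, regarded as a function on `[0, ∞)`, has a piecewise continuous derivative: on every bounded
interval `(0, T)` it is differentiable with continuous derivative off a finite set, and the
derivative has finite one-sided limits everywhere. At the exceptional points `j` may have a corner
or a jump. -/
def HasPiecewiseContinuousDeriv (j : ℝ → ℝ) : Prop :=
  ∀ T : ℝ, 0 < T →
    (∃ S : Finset ℝ, ∀ t ∈ Ioo 0 T, t ∉ S → DifferentiableAt ℝ j t ∧ ContinuousAt (deriv j) t) ∧
    (∀ t ∈ Ico 0 T, ∃ l : ℝ, Tendsto (deriv j) (𝓝[>] t) (𝓝 l)) ∧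
    (∀ t ∈ Ioc 0 T, ∃ l : ℝ, Tendsto (deriv j) (𝓝[<] t) (𝓝 l))

/-- `û₀(z) = ∫₀¹ e^{z x} u₀(x) dx`. -/
def uHat (u₀ : ℝ → ℝ) (z : ℂ) : ℂ :=
  ∫ x in (0 : ℝ)..1, Complex.exp (z * x) * (u₀ x : ℂ)

/-- `ĵ(z, t) = ∫₀ᵗ e^{z s} j(s) ds`. -/
def jHat (j : ℝ → ℝ) (z : ℂ) (t : ℝ) : ℂ :=
  ∫ s in (0 : ℝ)..t, Complex.exp (z * s) * (j s : ℂ)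

/-- `Δ(z) = e^{-iz}(1 + iz) - e^{iz}(1 - iz)`. -/
def Delta (z : ℂ) : ℂ :=
  Complex.exp (-(Complex.I * z)) * (1 + Complex.I * z)
    - Complex.exp (Complex.I * z) * (1 - Complex.I * z)

/-- `μ₀(z) = (iz + 1) e^{-iz} û₀(iz) + (iz - 1) e^{iz} û₀(-iz) + 2iz ĵ(z², t)`. -/
def mu0 (u₀ j : ℝ → ℝ) (t : ℝ) (z : ℂ) : ℂ :=
  (Complex.I * z + 1) * Complex.exp (-(Complex.I * z)) * uHat u₀ (Complex.I * z)
    + (Complex.I * z - 1) * Complex.exp (Complex.I * z) * uHat u₀ (-(Complex.I * z))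
    + 2 * Complex.I * z * jHat j (z ^ 2) t

/-- `μ₁(z) = μ₀(z) - Δ(z) û₀(-iz)`. -/
def mu1 (u₀ j : ℝ → ℝ) (t : ℝ) (z : ℂ) : ℂ :=
  mu0 u₀ j t z - Delta z * uHat u₀ (-(Complex.I * z))

/-- The elementary solution `e^{izx - z²t}` of the heat equation. -/
def elem (x t : ℝ) (z : ℂ) : ℂ :=
  Complex.exp (Complex.I * z * x - z ^ 2 * t)

/-- Integrand on the real line. -/
def integrandReal (u₀ : ℝ → ℝ) (x t : ℝ) (z : ℂ) : ℂ :=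
  elem x t z * uHat u₀ (-(Complex.I * z))

/-- Integrand on `∂D₊`. -/
def integrandPlus (u₀ j : ℝ → ℝ) (x t : ℝ) (z : ℂ) : ℂ :=
  elem x t z / Delta z * mu0 u₀ j t z

/-- Integrand on `∂D₋`. -/
def integrandMinus (u₀ j : ℝ → ℝ) (x t : ℝ) (z : ℂ) : ℂ :=
  elem x t z / Delta z * mu1 u₀ j t z

/-- Integral of `F` along the ray `{a + r e^{iθ} : r > 0}`, directed from `a` to infinity. -/
def rayIntegral (F : ℂ → ℂ) (a : ℂ) (θ : ℝ) : ℂ :=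
  ∫ r in Ioi (0 : ℝ), F (a + r * Complex.exp (θ * Complex.I)) * Complex.exp (θ * Complex.I)

/-- Absolute convergence of the integral of `F` along the ray `{a + r e^{iθ} : r > 0}`. -/
def RayIntegrable (F : ℂ → ℂ) (a : ℂ) (θ : ℝ) : Prop :=
  IntegrableOn (fun r : ℝ => F (a + r * Complex.exp (θ * Complex.I))) (Ioi 0)

/-- Integral over the boundary of the sector `{a + w : α ≤ arg w ≤ β}`, oriented with the sector on
its left: in along the ray of direction `β`, out along the ray of direction `α`. -/
def sectorBoundaryIntegral (F : ℂ → ℂ) (a : ℂ) (α β : ℝ) : ℂ :=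
  rayIntegral F a α - rayIntegral F a β

/-- Integral over `∂D₊`, `D₊ = {w + iε : π/4 ≤ arg w ≤ 3π/4}`. -/
def integralDPlus (ε : ℝ) (F : ℂ → ℂ) : ℂ :=
  sectorBoundaryIntegral F (ε * Complex.I) (Real.pi / 4) (3 * Real.pi / 4)

/-- Integral over `∂D₋`, `D₋ = {w - iε : 5π/4 ≤ arg w ≤ 7π/4}`. -/
def integralDMinus (ε : ℝ) (F : ℂ → ℂ) : ℂ :=
  sectorBoundaryIntegral F (-(ε * Complex.I)) (5 * Real.pi / 4) (7 * Real.pi / 4)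

/-- All contour integrals of the representation at `(x, t)` converge absolutely. -/
def RepresentationConverges (u₀ j : ℝ → ℝ) (ε x t : ℝ) : Prop :=
  Integrable (fun l : ℝ => integrandReal u₀ x t l) ∧
  RayIntegrable (integrandPlus u₀ j x t) (ε * Complex.I) (Real.pi / 4) ∧
  RayIntegrable (integrandPlus u₀ j x t) (ε * Complex.I) (3 * Real.pi / 4) ∧
  RayIntegrable (integrandMinus u₀ j x t) (-(ε * Complex.I)) (5 * Real.pi / 4) ∧
  RayIntegrable (integrandMinus u₀ j x t) (-(ε * Complex.I)) (7 * Real.pi / 4)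

/-- The integral representation
`(2π)⁻¹ (∫_ℝ e^{iλx-λ²t} û₀(-iλ) dλ - ∫_{∂D₊} e^{iλx-λ²t} μ₀/Δ dλ - ∫_{∂D₋} e^{iλx-λ²t} μ₁/Δ dλ)`
of the solution. -/
def representation (u₀ j : ℝ → ℝ) (ε x t : ℝ) : ℂ :=
  1 / (2 * (Real.pi : ℂ)) *
    ((∫ l : ℝ, integrandReal u₀ x t l)
      - integralDPlus ε (integrandPlus u₀ j x t)
      - integralDMinus ε (integrandMinus u₀ j x t))

/-- `u` is the function on `[0, 1] × (0, ∞)` given by the integral representation: at interior points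
`0 < x < 1` the contour integrals converge absolutely and give `u x t` (for every contour shift `ε`
that is small enough for the factor `e^{-λ²t}`, which grows like `e^{√2 ε t |λ|}` on the shifted
rays, to be controlled by the decay of the other factors), and the values at `x = 0` and `x = 1` are
the limits of the interior ones. These conditions determine `u` on `[0, 1] × (0, ∞)`. -/
def IsRepresentedSolution (u₀ j : ℝ → ℝ) (u : ℝ → ℝ → ℂ) : Prop :=
  ∀ t : ℝ, 0 < t →
    ContinuousOn (fun x => u x t) (Icc 0 1) ∧
    ∀ x ∈ Ioo (0 : ℝ) 1, ∀ ε : ℝ, 0 < ε → 2 * ε * t < x → 2 * ε * t < 1 - x →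
      RepresentationConverges u₀ j ε x t ∧ u x t = representation u₀ j ε x t

end SingleParticle

end

/-!
The substitution `z ↦ -z` turns the integral over `∂D₋` into one over `∂D₊`, and the decay of the
integrands in the two sectors between `∂D₊` and the real directions allows both contours to be moved
to the line `Im z = 1`. There the integrals converge for all `x ∈ [0, 1]`, and they define the
continuous extension.

For the limit `t ↓ 0` the solution is split linearly. The flux `j` contributes `O(√t)`, whether or
not it is compatible with `u₀`. The datum `x ↦ x` has zero boundary data at both ends, so it
is a steady state, and the representation reproduces it exactly: on `Im z = 1` the integrand is
`f z / z²` with `f` odd, entire and bounded, whose integral is half a residue. Subtracting `u₀ 1`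
times it leaves a datum `w` vanishing at both endpoints. Then the transform of `w` and both boundary
coefficients are `O(|z|⁻²)`, so `e^{-z²t}` may be replaced by `1` up to an error that tends to `0`
uniformly in `x`; what remains is Fourier inversion of `w` on the real line, and boundary integrals
that vanish because the line can be pushed to `+i∞`.
-/

namespace SingleParticle

open Complex (I)
open scoped Real

noncomputable section

section Contours

lemma integrable_const_div_one_add_sq (C : ℝ) : Integrable fun x : ℝ => C / (1 + x ^ 2) := by
  simpa [div_eq_mul_inv] using integrable_inv_one_add_sq.const_mul C

lemma tendsto_const_div_one_add_sq_atTop (C : ℝ) :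
    Tendsto (fun x : ℝ => C / (1 + x ^ 2)) atTop (𝓝 0) :=
  tendsto_const_nhds.div_atTop
    (tendsto_atTop_add_const_left _ _ (tendsto_pow_atTop two_ne_zero))

lemma tendsto_const_div_one_add_sq_atBot (C : ℝ) :
    Tendsto (fun x : ℝ => C / (1 + x ^ 2)) atBot (𝓝 0) :=
  ((tendsto_const_div_one_add_sq_atTop C).comp tendsto_neg_atBot_atTop).congr fun x => by simp

lemma continuous_horizontalLine {X : Type*} [TopologicalSpace X] {f : ℂ → X} {v : ℝ}
    (hf : ∀ z : ℂ, z.im = v → ContinuousAt f z) : Continuous fun x : ℝ => f (x + v * I) :=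
  continuous_iff_continuousAt.2 fun x =>
    (hf _ (by simp)).comp (f := fun x : ℝ => (x + v * I : ℂ)) (by fun_prop)

variable {E : Type*} [NormedAddCommGroup E]

lemma integrable_horizontalLine {f : ℂ → E} {v C : ℝ}
    (hf : ∀ z : ℂ, z.im = v → ContinuousAt f z)
    (hbound : ∀ x : ℝ, ‖f (x + v * I)‖ ≤ C / (1 + x ^ 2)) :
    Integrable fun x : ℝ => f (x + v * I) :=
  (integrable_const_div_one_add_sq C).mono'
    (continuous_horizontalLine hf).aestronglyMeasurable (ae_of_all _ hbound)

variable [NormedSpace ℂ E]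

lemma integral_horizontalLine_eq_of_norm_le {f : ℂ → E} {a b : ℝ} {g : ℝ → ℝ} (hab : a ≤ b)
    (hd : ∀ z : ℂ, z.im ∈ Icc a b → DifferentiableAt ℂ f z)
    (hfg : ∀ x y : ℝ, y ∈ Icc a b → ‖f (x + y * I)‖ ≤ g x)
    (hg : Integrable g) (htop : Tendsto g atTop (𝓝 0)) (hbot : Tendsto g atBot (𝓝 0)) :
    ∫ x : ℝ, f (x + a * I) = ∫ x : ℝ, f (x + b * I) := by
  have hint : ∀ y ∈ Icc a b, Integrable fun x : ℝ => f (x + y * I) := fun y hy =>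
    hg.mono' (continuous_horizontalLine fun z hz => (hd z (hz ▸ hy)).continuousAt
      ).aestronglyMeasurable (ae_of_all _ fun x => hfg x y hy)
  have hvert : ∀ {l : Filter ℝ}, Tendsto g l (𝓝 0) →
      Tendsto (fun x : ℝ => ∫ y in a..b, f (x + y * I)) l (𝓝 0) := by
    intro l hl
    refine squeeze_zero_norm (fun x => ?_) (by simpa using hl.mul_const |b - a|)
    refine intervalIntegral.norm_integral_le_of_norm_le_const fun y hy => hfg x y ?_
    rw [uIoc_of_le hab] at hy
    exact Ioc_subset_Icc_self hy
  have hhor : ∀ y ∈ Icc a b, Tendsto (fun R : ℝ => ∫ x in -R..R, f (x + y * I)) atTop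
      (𝓝 (∫ x : ℝ, f (x + y * I))) := fun y hy =>
    intervalIntegral_tendsto_integral (hint y hy) tendsto_neg_atTop_atBot tendsto_id
  have hrect : ∀ R : ℝ, (∫ x in -R..R, f (x + a * I)) - (∫ x in -R..R, f (x + b * I))
      + I • (∫ y in a..b, f (R + y * I)) - I • (∫ y in a..b, f ((-R : ℝ) + y * I)) = 0 := by
    intro R
    simpa using Complex.integral_boundary_rect_eq_zero_of_differentiableOn f (-R + a * I)
      (R + b * I) fun z hz => (hd z (by simpa [uIcc_of_le hab] using hz.2)).differentiableWithinAt
  have hlim := (((hhor a ⟨le_rfl, hab⟩).sub (hhor b ⟨hab, le_rfl⟩)).add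
    ((hvert htop).const_smul I)).sub (((hvert hbot).comp tendsto_neg_atTop_atBot).const_smul I)
  simpa [sub_eq_zero] using tendsto_nhds_unique (hlim.congr hrect) tendsto_const_nhds

lemma integral_horizontalLine_eq {f : ℂ → E} {a b C : ℝ} (hab : a ≤ b)
    (hd : ∀ z : ℂ, z.im ∈ Icc a b → DifferentiableAt ℂ f z)
    (hf : ∀ x y : ℝ, y ∈ Icc a b → ‖f (x + y * I)‖ ≤ C / (1 + x ^ 2)) :
    ∫ x : ℝ, f (x + a * I) = ∫ x : ℝ, f (x + b * I) :=
  integral_horizontalLine_eq_of_norm_le hab hd hf (integrable_const_div_one_add_sq C)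
    (tendsto_const_div_one_add_sq_atTop C) (tendsto_const_div_one_add_sq_atBot C)

variable {F : Type*} [NormedAddCommGroup F] [NormedSpace ℝ F]

lemma integral_Ioi_zero_eq_integral_comp_exp (f : ℝ → F) :
    ∫ r in Ioi (0 : ℝ), f r = ∫ x : ℝ, Real.exp x • f (Real.exp x) := by
  have h := integral_image_eq_integral_abs_deriv_smul MeasurableSet.univ
    (fun x _ => (Real.hasDerivAt_exp x).hasDerivWithinAt) Real.exp_injective.injOn f
  simpa [Real.range_exp] using h

lemma integrableOn_Ioi_zero_iff_integrable_comp_exp {f : ℝ → F} :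
    IntegrableOn f (Ioi 0) ↔ Integrable fun x : ℝ => Real.exp x • f (Real.exp x) := by
  have h := integrableOn_image_iff_integrableOn_abs_deriv_smul MeasurableSet.univ
    (fun x _ => (Real.hasDerivAt_exp x).hasDerivWithinAt) Real.exp_injective.injOn f
  simpa [Real.range_exp] using h

lemma rayIntegrable_of_norm_le {f : ℂ → ℂ} {a : ℂ} {θ C : ℝ}
    (hc : ∀ r : ℝ, 0 < r → ContinuousAt f (a + r * Complex.exp (θ * I)))
    (hf : ∀ r : ℝ, 0 < r → ‖f (a + r * Complex.exp (θ * I))‖ ≤ C / (1 + r ^ 2)) :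
    RayIntegrable f a θ := by
  have hcont : ContinuousOn (fun r : ℝ => f (a + r * Complex.exp (θ * I))) (Ioi 0) := fun r hr =>
    ((hc r hr).comp (f := fun r : ℝ => a + r * Complex.exp (θ * I))
      (by fun_prop)).continuousWithinAt
  exact (integrable_const_div_one_add_sq C).integrableOn.mono'
    (hcont.aestronglyMeasurable measurableSet_Ioi)
    ((ae_restrict_iff' measurableSet_Ioi).2 (ae_of_all _ hf))

lemma tendsto_mul_const_div_one_add_sq_atTop (C : ℝ) :
    Tendsto (fun r : ℝ => r * (C / (1 + r ^ 2))) atTop (𝓝 0) := by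
  have hlim : Tendsto (fun r : ℝ => |C| / r) atTop (𝓝 0) :=
    tendsto_const_nhds.div_atTop tendsto_id
  refine squeeze_zero_norm' ?_ hlim
  filter_upwards [eventually_gt_atTop 0] with r hr
  rw [norm_mul, norm_div, Real.norm_of_nonneg hr.le, Real.norm_eq_abs,
    Real.norm_of_nonneg (by positivity), ← mul_div_assoc, div_le_div_iff₀ (by positivity) hr]
  nlinarith [abs_nonneg C]

lemma tendsto_mul_const_div_one_add_sq_zero (C : ℝ) :
    Tendsto (fun r : ℝ => r * (C / (1 + r ^ 2))) (𝓝 0) (𝓝 0) := by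
  have hcont : Continuous fun r : ℝ => r * (C / (1 + r ^ 2)) :=
    continuous_id.mul (continuous_const.div (by fun_prop) fun r => by positivity)
  simpa using hcont.tendsto 0

lemma rayIntegral_eq_integral_exp (f : ℂ → ℂ) (a : ℂ) (θ : ℝ) :
    rayIntegral f a θ =
      ∫ x : ℝ, f (a + Complex.exp (x + θ * I)) * Complex.exp (x + θ * I) := by
  rw [rayIntegral, integral_Ioi_zero_eq_integral_comp_exp]
  refine integral_congr_ae (ae_of_all _ fun x => ?_)
  simp only [Complex.exp_add, Complex.ofReal_exp, Complex.real_smul]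
  ring

/-- In the coordinate `z = a + e^ζ` the rays from `a` become horizontal lines, so rotating a ray is
shifting a line. -/
lemma rayIntegral_eq_of_norm_le {f : ℂ → ℂ} {a : ℂ} {α β C : ℝ} (hαβ : α ≤ β)
    (hd : ∀ θ ∈ Icc α β, ∀ r : ℝ, 0 < r → DifferentiableAt ℂ f (a + r * Complex.exp (θ * I)))
    (hf : ∀ θ ∈ Icc α β, ∀ r : ℝ, 0 < r →
      ‖f (a + r * Complex.exp (θ * I))‖ ≤ C / (1 + r ^ 2)) :
    rayIntegral f a α = rayIntegral f a β := by
  have hexp : ∀ x y : ℝ, Complex.exp (x + y * I) = Real.exp x * Complex.exp (y * I) := fun x y => by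
    rw [Complex.exp_add, Complex.ofReal_exp]
  rw [rayIntegral_eq_integral_exp, rayIntegral_eq_integral_exp]
  refine integral_horizontalLine_eq_of_norm_le
    (f := fun ζ => f (a + Complex.exp ζ) * Complex.exp ζ)
    (g := fun x => Real.exp x * (C / (1 + Real.exp x ^ 2))) hαβ ?_ ?_ ?_
    ((tendsto_mul_const_div_one_add_sq_atTop C).comp Real.tendsto_exp_atTop)
    ((tendsto_mul_const_div_one_add_sq_zero C).comp Real.tendsto_exp_atBot)
  · intro ζ hζ
    have hray := hd ζ.im hζ (Real.exp ζ.re) (Real.exp_pos _)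
    rw [← hexp, Complex.re_add_im] at hray
    exact (hray.comp (f := fun ζ => a + Complex.exp ζ) ζ (by fun_prop)).mul (by fun_prop)
  · intro x y hy
    rw [norm_mul, mul_comm, hexp]
    simpa [Complex.norm_exp] using
      mul_le_mul_of_nonneg_left (hf y hy _ (Real.exp_pos x)) (Real.exp_pos x).le
  · exact integrableOn_Ioi_zero_iff_integrable_comp_exp (f := fun r => C / (1 + r ^ 2)) |>.1
      (integrable_const_div_one_add_sq C).integrableOn

lemma rayIntegral_zero_sub_rayIntegral_pi {f : ℂ → ℂ} {a : ℂ}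
    (hf : Integrable fun x : ℝ => f (x + a)) :
    rayIntegral f a 0 - rayIntegral f a π = ∫ x : ℝ, f (x + a) := by
  have hright : rayIntegral f a 0 = ∫ x in Ioi (0 : ℝ), f (x + a) := by
    simp [rayIntegral, add_comm]
  have hleft : rayIntegral f a π = -∫ x in Iic (0 : ℝ), f (x + a) := by
    have hneg := integral_comp_neg_Ioi (0 : ℝ) fun x : ℝ => f (x + a)
    rw [neg_zero] at hneg
    rw [← hneg, rayIntegral, ← integral_neg]
    simp [Complex.exp_pi_mul_I, add_comm]
  rw [hright, hleft, sub_neg_eq_add, add_comm]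
  exact intervalIntegral.integral_Iic_add_Ioi hf.integrableOn hf.integrableOn

lemma exp_pi_add_mul_I (θ : ℝ) : Complex.exp ((π + θ : ℝ) * I) = -Complex.exp (θ * I) := by
  rw [Complex.ofReal_add, add_mul, Complex.exp_add, Complex.exp_pi_mul_I, neg_one_mul]

lemma rayIntegral_neg_pi_add (f : ℂ → ℂ) (a : ℂ) (θ : ℝ) :
    rayIntegral f (-a) (π + θ) = -rayIntegral (fun z => f (-z)) a θ := by
  simp only [rayIntegral, exp_pi_add_mul_I, mul_neg, integral_neg, neg_add]

lemma rayIntegrable_neg_pi_add_iff {f : ℂ → ℂ} {a : ℂ} {θ : ℝ} :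
    RayIntegrable f (-a) (π + θ) ↔ RayIntegrable (fun z => f (-z)) a θ := by
  simp only [RayIntegrable, exp_pi_add_mul_I, mul_neg, neg_add]

lemma integralDMinus_eq_neg_integralDPlus (ε : ℝ) (f : ℂ → ℂ) :
    integralDMinus ε f = -integralDPlus ε (fun z => f (-z)) := by
  rw [integralDMinus, integralDPlus, sectorBoundaryIntegral, sectorBoundaryIntegral,
    show 5 * π / 4 = π + π / 4 by ring, show 7 * π / 4 = π + 3 * π / 4 by ring,
    rayIntegral_neg_pi_add, rayIntegral_neg_pi_add, neg_sub_neg, neg_sub]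

end Contours

section Transforms

lemma differentiable_integral_exp_mul {f : ℝ → ℂ} {a b : ℝ}
    (hf : IntervalIntegrable f volume a b) :
    Differentiable ℂ fun z : ℂ => ∫ x in a..b, Complex.exp (z * x) * f x := by
  intro z₀
  obtain ⟨R, hR⟩ := isCompact_uIcc.exists_bound_of_continuousOn (continuousOn_id (s := uIcc a b))
  have hm : AEStronglyMeasurable f (volume.restrict (uIoc a b)) := hf.def'.aestronglyMeasurable
  refine (intervalIntegral.hasDerivAt_integral_of_dominated_loc_of_deriv_le
    (F := fun z x => Complex.exp (z * x) * f x) (F' := fun z x => Complex.exp (z * x) * x * f x)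
    (bound := fun x => Real.exp ((‖z₀‖ + 1) * R) * R * ‖f x‖) (Metric.ball_mem_nhds z₀ one_pos)
    (Eventually.of_forall fun z => (Continuous.aestronglyMeasurable (by fun_prop)).mul hm)
    (hf.continuousOn_mul (Continuous.continuousOn (by fun_prop)))
    ((Continuous.aestronglyMeasurable (by fun_prop)).mul hm) ?_ (hf.norm.const_mul _)
    ?_).2.differentiableAt
  · refine ae_of_all _ fun x hx z hz => ?_
    have hz' : ‖z‖ ≤ ‖z₀‖ + 1 := by
      linarith [norm_le_norm_add_norm_sub' z z₀, mem_ball_iff_norm.1 hz]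
    have hx' : |x| ≤ R := hR x (uIoc_subset_uIcc hx)
    rw [norm_mul, norm_mul, Complex.norm_real, Complex.norm_exp, Real.norm_eq_abs]
    gcongr
    refine (Complex.re_le_norm _).trans ?_
    rw [norm_mul, Complex.norm_real, Real.norm_eq_abs]
    gcongr
  · refine ae_of_all _ fun x _ z _ => ?_
    simpa using (((hasDerivAt_id z).mul_const (x : ℂ)).cexp).mul_const (f x)

lemma norm_exp_mul_ofReal_le_one {w : ℂ} {x : ℝ} (hw : w.re ≤ 0) (hx : 0 ≤ x) :
    ‖Complex.exp (w * x)‖ ≤ 1 := by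
  rw [Complex.norm_exp, Real.exp_le_one_iff, Complex.re_mul_ofReal]
  exact mul_nonpos_of_nonpos_of_nonneg hw hx

lemma intervalIntegrable_ofReal_of_continuousOn {f : ℝ → ℝ} (hf : ContinuousOn f (Icc 0 1)) :
    IntervalIntegrable (fun x => (f x : ℂ)) volume 0 1 :=
  ContinuousOn.intervalIntegrable <| by
    rw [uIcc_of_le zero_le_one]
    exact Complex.continuous_ofReal.comp_continuousOn hf

lemma differentiable_uHat {f : ℝ → ℝ} (hf : ContinuousOn f (Icc 0 1)) :
    Differentiable ℂ (uHat f) :=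
  differentiable_integral_exp_mul (intervalIntegrable_ofReal_of_continuousOn hf)

lemma uHat_add_smul {f g : ℝ → ℝ} (hf : ContinuousOn f (Icc 0 1))
    (hg : ContinuousOn g (Icc 0 1)) (c : ℝ) (w : ℂ) :
    uHat (f + c • g) w = uHat f w + c * uHat g w := by
  have hint : ∀ {h : ℝ → ℝ}, ContinuousOn h (Icc 0 1) →
      IntervalIntegrable (fun x : ℝ => Complex.exp (w * x) * (h x : ℂ)) volume 0 1 := fun hh =>
    (intervalIntegrable_ofReal_of_continuousOn hh).continuousOn_mul (by fun_prop)
  rw [uHat, uHat, uHat, ← intervalIntegral.integral_const_mul,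
    ← intervalIntegral.integral_add (hint hf) ((hint hg).const_mul _)]
  refine intervalIntegral.integral_congr fun x _ => ?_
  simp only [Pi.add_apply, Pi.smul_apply, smul_eq_mul, Complex.ofReal_add, Complex.ofReal_mul]
  ring

lemma norm_uHat_le {f : ℝ → ℝ} {K : ℝ} (hf : ∀ x ∈ Icc (0 : ℝ) 1, |f x| ≤ K) {w : ℂ}
    (hw : w.re ≤ 0) : ‖uHat f w‖ ≤ K := by
  have hbound : ∀ x ∈ uIoc (0 : ℝ) 1, ‖Complex.exp (w * x) * (f x : ℂ)‖ ≤ K := fun x hx => by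
    rw [uIoc_of_le zero_le_one] at hx
    rw [norm_mul, Complex.norm_real, Real.norm_eq_abs]
    exact (mul_le_of_le_one_left (abs_nonneg _) (norm_exp_mul_ofReal_le_one hw hx.1.le)).trans
      (hf x (Ioc_subset_Icc_self hx))
  simpa [uHat] using intervalIntegral.norm_integral_le_of_norm_le_const hbound

lemma exists_norm_uHat_le {f : ℝ → ℝ} (hf : ContinuousOn f (Icc 0 1)) :
    ∃ K : ℝ, ∀ w : ℂ, w.re ≤ 0 → ‖uHat f w‖ ≤ K := by
  obtain ⟨K, hK⟩ := isCompact_Icc.exists_bound_of_continuousOn hf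
  exact ⟨K, fun w hw => norm_uHat_le hK hw⟩

lemma mul_uHat {f f' : ℝ → ℝ} (hf : ContinuousOn f (Icc 0 1)) (hf' : ContinuousOn f' (Icc 0 1))
    (hd : ∀ x ∈ Ioo (0 : ℝ) 1, HasDerivAt f (f' x) x) (w : ℂ) :
    w * uHat f w = Complex.exp w * f 1 - f 0 - uHat f' w := by
  have hexp : ∀ x : ℝ, HasDerivAt (fun x : ℝ => Complex.exp (w * x)) (Complex.exp (w * x) * w) x :=
    fun x => by simpa using ((Complex.ofRealCLM.hasDerivAt (x := x)).const_mul w).cexp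
  have hparts := intervalIntegral.integral_mul_deriv_eq_deriv_mul_of_hasDerivAt (a := 0) (b := 1)
    (u := fun x : ℝ => (f x : ℂ)) (u' := fun x : ℝ => (f' x : ℂ))
    (v := fun x : ℝ => Complex.exp (w * x))
    (by rw [uIcc_of_le zero_le_one]; exact Complex.continuous_ofReal.comp_continuousOn hf)
    (by fun_prop) (by simpa using fun x h0 h1 => (hd x ⟨h0, h1⟩).ofReal_comp)
    (fun x _ => hexp x) (intervalIntegrable_ofReal_of_continuousOn hf')
    (Continuous.intervalIntegrable (by fun_prop) _ _)
  simp only [Complex.ofReal_one, mul_one, Complex.ofReal_zero, mul_zero, Complex.exp_zero]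
    at hparts
  have hleft : w * uHat f w = ∫ x : ℝ in (0 : ℝ)..1, (f x : ℂ) * (Complex.exp (w * x) * w) := by
    rw [uHat, ← intervalIntegral.integral_const_mul]
    refine intervalIntegral.integral_congr fun x _ => ?_
    ring
  have hright : uHat f' w = ∫ x : ℝ in (0 : ℝ)..1, (f' x : ℂ) * Complex.exp (w * x) :=
    intervalIntegral.integral_congr fun x _ => mul_comm (Complex.exp (w * x)) (f' x : ℂ)
  rw [hleft, hright, mul_comm (Complex.exp w)]
  exact hparts

/-- Two integrations by parts; the boundary terms of the first one vanish. -/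
lemma exists_sq_mul_norm_uHat_le {f : ℝ → ℝ} (hf : ContDiffOn ℝ 2 f (Icc 0 1)) (h0 : f 0 = 0)
    (h1 : f 1 = 0) : ∃ K : ℝ, ∀ w : ℂ, w.re ≤ 0 → ‖w‖ ^ 2 * ‖uHat f w‖ ≤ K := by
  have hunique : UniqueDiffOn ℝ (Icc (0 : ℝ) 1) := uniqueDiffOn_Icc zero_lt_one
  have hderiv : ∀ {g : ℝ → ℝ}, ContDiffOn ℝ 1 g (Icc 0 1) → ∀ x ∈ Ioo (0 : ℝ) 1,
      HasDerivAt g (derivWithin g (Icc 0 1) x) x := fun hg x hx =>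
    ((hg.differentiableOn one_ne_zero x (Ioo_subset_Icc_self hx)).hasDerivWithinAt).hasDerivAt
      (Icc_mem_nhds hx.1 hx.2)
  set f' := derivWithin f (Icc 0 1)
  have hf' : ContDiffOn ℝ 1 f' (Icc 0 1) := hf.derivWithin hunique (by norm_num)
  have hf'' := hf'.continuousOn_derivWithin hunique le_rfl
  obtain ⟨K, hK⟩ := exists_norm_uHat_le hf''
  refine ⟨|f' 1| + |f' 0| + K, fun w hw => ?_⟩
  have hfirst := mul_uHat hf.continuousOn hf'.continuousOn (hderiv (hf.of_le one_le_two)) w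
  have hsecond := mul_uHat hf'.continuousOn hf'' (hderiv hf') w
  have hsq : w ^ 2 * uHat f w =
      -(Complex.exp w * f' 1 - f' 0 - uHat (derivWithin f' (Icc 0 1)) w) := by
    rw [← hsecond, pow_two, mul_assoc, hfirst, h0, h1]
    push_cast
    ring
  have hexp : ‖Complex.exp w‖ ≤ 1 := by simpa using norm_exp_mul_ofReal_le_one hw zero_le_one
  rw [← norm_pow, ← norm_mul, hsq, norm_neg]
  refine (norm_sub_le _ _).trans (add_le_add ((norm_sub_le _ _).trans (add_le_add ?_ ?_)) (hK w hw))
  · rw [norm_mul, Complex.norm_real, Real.norm_eq_abs]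
    exact mul_le_of_le_one_left (abs_nonneg _) hexp
  · rw [Complex.norm_real, Real.norm_eq_abs]

lemma exp_mul_uHat_neg (f : ℝ → ℝ) (w : ℂ) :
    Complex.exp w * uHat f (-w) = uHat (fun x => f (1 - x)) w := by
  have hreflect := intervalIntegral.integral_comp_sub_left
    (f := fun x : ℝ => Complex.exp (w * ((1 - x : ℝ) : ℂ)) * (f x : ℂ)) (a := 0) (b := 1) 1
  simp only [sub_sub_cancel, sub_self, sub_zero] at hreflect
  rw [uHat, uHat, ← intervalIntegral.integral_const_mul, hreflect]
  refine intervalIntegral.integral_congr fun x _ => ?_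
  rw [← mul_assoc, ← Complex.exp_add]
  congr 2
  push_cast
  ring

lemma continuousOn_comp_one_sub {X : Type*} [TopologicalSpace X] {f : ℝ → X}
    (hf : ContinuousOn f (Icc 0 1)) : ContinuousOn (fun x => f (1 - x)) (Icc 0 1) :=
  hf.comp (by fun_prop) fun x hx => ⟨by linarith [hx.2], by linarith [hx.1]⟩

end Transforms

section Denominator

lemma Delta_eq (z : ℂ) : Delta z = 2 * I * (z * Complex.cos z - Complex.sin z) := by
  rw [Delta, mul_comm I z, ← neg_mul, Complex.exp_mul_I, Complex.exp_mul_I, Complex.cos_neg,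
    Complex.sin_neg]
  ring

lemma Delta_neg (z : ℂ) : Delta (-z) = -Delta z := by
  rw [Delta_eq, Delta_eq, Complex.cos_neg, Complex.sin_neg]
  ring

lemma differentiable_Delta : Differentiable ℂ Delta := by
  unfold Delta
  fun_prop

lemma sinh_lt_mul_cosh {b : ℝ} (hb : 0 < b) : Real.sinh b < b * Real.cosh b := by
  have hderiv : ∀ x : ℝ, HasDerivAt (fun x => x * Real.cosh x - Real.sinh x) (x * Real.sinh x) x :=
    fun x => (((hasDerivAt_id' x).mul (Real.hasDerivAt_cosh x)).sub
      (Real.hasDerivAt_sinh x)).congr_deriv (by ring)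
  have hmono : StrictMonoOn (fun x => x * Real.cosh x - Real.sinh x) (Ici 0) := by
    refine strictMonoOn_of_deriv_pos (convex_Ici 0) (by fun_prop) fun x hx => ?_
    rw [interior_Ici] at hx
    rw [(hderiv x).deriv]
    exact mul_pos hx (Real.sinh_pos_iff.2 hx)
  simpa using hmono (mem_Ici.2 le_rfl) (mem_Ici.2 hb.le) hb

lemma normSq_cos (z : ℂ) :
    Complex.normSq (Complex.cos z) = Real.cos z.re ^ 2 + Real.sinh z.im ^ 2 := by
  rw [Complex.cos_eq, ← Complex.ofReal_cos, ← Complex.ofReal_sin, ← Complex.ofReal_cosh,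
    ← Complex.ofReal_sinh, ← Complex.ofReal_mul, ← Complex.ofReal_mul, sub_eq_add_neg, ← neg_mul,
    ← Complex.ofReal_neg, Complex.normSq_add_mul_I]
  linear_combination Real.cos z.re ^ 2 * Real.cosh_sq z.im
    + Real.sinh z.im ^ 2 * Real.sin_sq_add_cos_sq z.re

lemma sin_mul_conj_cos (z : ℂ) :
    Complex.sin z * (starRingEnd ℂ) (Complex.cos z) =
      (Real.sin z.re * Real.cos z.re : ℝ) + (Real.sinh z.im * Real.cosh z.im : ℝ) * I := by
  rw [Complex.cos_eq, Complex.sin_eq]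
  simp only [map_sub, map_mul, ← Complex.ofReal_cos, ← Complex.ofReal_sin, ← Complex.ofReal_cosh,
    ← Complex.ofReal_sinh, Complex.conj_ofReal, Complex.conj_I]
  push_cast
  linear_combination (Complex.sin z.re * Complex.cos z.re) * Complex.cosh_sq z.im
    + (I * Complex.sinh z.im * Complex.cosh z.im) * Complex.sin_sq_add_cos_sq z.re
    + (Complex.sin z.re * Complex.cos z.re * Complex.sinh z.im ^ 2) * Complex.I_sq

/-- If `z cos z = sin z`, multiplying by the conjugate of `cos z` gives
`a |cos z|² = sin a cos a` and `b |cos z|² = sinh b cosh b` for `z = a + ib`: the second equation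
forces `|cos z|² > 1`, then the first one `a = 0`. -/
lemma Delta_ne_zero {z : ℂ} (hz : 0 < z.im) : Delta z ≠ 0 := by
  intro h
  rw [Delta_eq, mul_eq_zero, or_iff_right (by simp), sub_eq_zero] at h
  set a := z.re
  set b := z.im
  set N := Real.cos a ^ 2 + Real.sinh b ^ 2 with hN
  have hzN : z * N = (Real.sin a * Real.cos a : ℝ) + (Real.sinh b * Real.cosh b : ℝ) * I := by
    rw [← sin_mul_conj_cos, ← h, mul_assoc, Complex.mul_conj, normSq_cos]
  have haN : a * N = Real.sin a * Real.cos a := by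
    simpa only [Complex.re_mul_ofReal, Complex.add_re, Complex.ofReal_re, Complex.re_ofReal_mul,
      Complex.I_re, mul_zero, add_zero] using congrArg Complex.re hzN
  have hbN : b * N = Real.sinh b * Real.cosh b := by
    simpa only [Complex.im_mul_ofReal, Complex.add_im, Complex.ofReal_im, Complex.im_ofReal_mul,
      Complex.I_im, mul_one, zero_add] using congrArg Complex.im hzN
  have hN1 : 1 < N := by
    have hb := Real.self_le_sinh_iff.2 hz.le
    have hcosh : 1 < Real.cosh b := Real.one_lt_cosh.2 hz.ne'
    exact lt_of_mul_lt_mul_left (by nlinarith : b * 1 < b * N) hz.le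
  have ha : a = 0 := by
    by_contra ha
    have habs : |a| * N = |Real.sin a| * |Real.cos a| := by
      rw [← abs_mul, ← haN, abs_mul, abs_of_pos (by linarith : 0 < N)]
    nlinarith [Real.abs_sin_lt_abs ha, Real.abs_cos_le_one a, abs_nonneg (Real.sin a),
      abs_nonneg (Real.cos a), abs_pos.2 ha]
  have hcosh : N = Real.cosh b ^ 2 := by rw [hN, ha, Real.cos_zero, Real.cosh_sq]; ring
  rw [hcosh] at hbN
  nlinarith [sinh_lt_mul_cosh hz, Real.cosh_pos b]

lemma norm_exp_I_mul (z : ℂ) : ‖Complex.exp (I * z)‖ = Real.exp (-z.im) := by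
  simp [Complex.norm_exp]

lemma norm_exp_neg_I_mul (z : ℂ) : ‖Complex.exp (-(I * z))‖ = Real.exp z.im := by
  simp [Complex.norm_exp]

lemma norm_one_add_I_mul_le (z : ℂ) : ‖1 + I * z‖ ≤ 1 + ‖z‖ := by
  simpa using norm_add_le 1 (I * z)

lemma norm_one_sub_I_mul_le (z : ℂ) : ‖1 - I * z‖ ≤ 1 + ‖z‖ := by
  simpa using norm_sub_le 1 (I * z)

lemma exp_mul_sub_exp_mul_le_norm_Delta (z : ℂ) :
    Real.exp z.im * (‖z‖ - 1) - Real.exp (-z.im) * (1 + ‖z‖) ≤ ‖Delta z‖ := by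
  have hlarge : ‖z‖ - 1 ≤ ‖1 + I * z‖ := by
    simpa [add_comm] using norm_sub_norm_le (I * z) (-1)
  calc Real.exp z.im * (‖z‖ - 1) - Real.exp (-z.im) * (1 + ‖z‖)
      ≤ Real.exp z.im * ‖1 + I * z‖ - Real.exp (-z.im) * ‖1 - I * z‖ := by
        gcongr
        exact norm_one_sub_I_mul_le z
    _ ≤ ‖Delta z‖ := by
        rw [← norm_exp_I_mul, ← norm_exp_neg_I_mul, ← norm_mul, ← norm_mul]
        exact norm_sub_norm_le _ _

/-- For large `‖z‖` the exponential `e^{-iz}` in `Δ` dominates; compactness covers the rest. -/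
lemma exists_one_add_norm_mul_exp_le_mul_norm_Delta {ε : ℝ} (hε : 0 < ε) :
    ∃ C : ℝ, ∀ z : ℂ, ε ≤ z.im → (1 + ‖z‖) * Real.exp z.im ≤ C * ‖Delta z‖ := by
  set q := Real.exp (-(2 * ε)) with hq
  have hq0 : 0 < q := Real.exp_pos _
  have hq1 : q < 1 := Real.exp_lt_one_iff.2 (by linarith)
  set R := (3 + q) / (1 - q) with hR
  have hcompact : IsCompact ({z : ℂ | ε ≤ z.im} ∩ Metric.closedBall 0 R) :=
    (isCompact_closedBall 0 R).inter_left (isClosed_le continuous_const Complex.continuous_im)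
  obtain ⟨K, hK⟩ := hcompact.exists_bound_of_continuousOn
    (f := fun z => (1 + ‖z‖) * Real.exp z.im / ‖Delta z‖)
    (ContinuousOn.div (by fun_prop) differentiable_Delta.continuous.norm.continuousOn
      fun z hz => norm_ne_zero_iff.2 (Delta_ne_zero (hε.trans_le hz.1)))
  refine ⟨max K (2 / (1 - q)), fun z hz => ?_⟩
  have hΔ : 0 < ‖Delta z‖ := norm_pos_iff.2 (Delta_ne_zero (hε.trans_le hz))
  rw [← div_le_iff₀ hΔ]
  rcases le_or_gt ‖z‖ R with hzR | hzR
  · exact (le_abs_self _).trans ((hK z ⟨hz, by simpa using hzR⟩).trans (le_max_left _ _))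
  · refine le_trans ?_ (le_max_right _ _)
    have hexp : Real.exp (-z.im) ≤ q * Real.exp z.im := by
      rw [hq, ← Real.exp_add]
      exact Real.exp_le_exp.2 (by linarith)
    have hlarge : 3 + q < (1 - q) * ‖z‖ := by
      rwa [hR, div_lt_iff₀ (by linarith), mul_comm] at hzR
    rw [div_le_div_iff₀ hΔ (by linarith)]
    calc (1 + ‖z‖) * Real.exp z.im * (1 - q)
        ≤ 2 * (Real.exp z.im * (‖z‖ - 1) - q * Real.exp z.im * (1 + ‖z‖)) := by
          nlinarith [Real.exp_pos z.im]
      _ ≤ 2 * (Real.exp z.im * (‖z‖ - 1) - Real.exp (-z.im) * (1 + ‖z‖)) := by gcongr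
      _ ≤ 2 * ‖Delta z‖ := by gcongr; exact exp_mul_sub_exp_mul_le_norm_Delta z

end Denominator

section Coefficients

/-- The factor of `e^{izx - z²t}` in the initial-data part of the integrand on `∂D₊`, where
`e^{iz} û(-iz)` is written as the transform of the reflected function `x ↦ u (1 - x)`. -/
def coefPlus (u : ℝ → ℝ) (z : ℂ) : ℂ :=
  ((1 + I * z) * Complex.exp (-(I * z)) * uHat u (I * z)
    - (1 - I * z) * uHat (fun x => u (1 - x)) (I * z)) / Delta z

/-- The factor of `e^{iz(1-x) - z²t}` in the initial-data part of the integrand on `∂D₋`, after the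
reflection `z ↦ -z` into the upper half-plane. -/
def coefMinus (u : ℝ → ℝ) (z : ℂ) : ℂ :=
  (1 - I * z) * (uHat u (I * z) - Complex.exp (-(I * z)) * uHat (fun x => u (1 - x)) (I * z))
    / Delta z

/-- The factor of `e^{izx - z²t} ĵ(z², t)` in the integrand on `∂D₊`. -/
def fluxPlus (z : ℂ) : ℂ := 2 * I * z / Delta z

/-- The factor of `e^{iz(1-x) - z²t} ĵ(z², t)` in the integrand on `∂D₋`, after the reflection
`z ↦ -z` into the upper half-plane. -/
def fluxMinus (z : ℂ) : ℂ := 2 * I * z * Complex.exp (-(I * z)) / Delta z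

/-- `M` is holomorphic in the upper half-plane and bounded on every half-plane `a ≤ Im z`, `a > 0`:
the property of the coefficients of the integrands that allows the contours to be moved. -/
structure IsContourMultiplier (M : ℂ → ℂ) : Prop where
  differentiableAt : ∀ z : ℂ, 0 < z.im → DifferentiableAt ℂ M z
  exists_norm_le : ∀ a : ℝ, 0 < a → ∃ C : ℝ, ∀ z : ℂ, a ≤ z.im → ‖M z‖ ≤ C

variable {z : ℂ} {c B : ℝ}

lemma norm_div_Delta_le {p : ℂ} (hΔ : (1 + ‖z‖) * Real.exp z.im ≤ c * ‖Delta z‖)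
    (hz : 0 < z.im) (hB : 0 ≤ B) (hp : ‖p‖ ≤ (1 + ‖z‖) * Real.exp z.im * B) :
    ‖p / Delta z‖ ≤ c * B := by
  rw [norm_div, div_le_iff₀ (norm_pos_iff.2 (Delta_ne_zero hz)), mul_right_comm]
  exact hp.trans (by gcongr)

lemma norm_fluxPlus_le (hΔ : (1 + ‖z‖) * Real.exp z.im ≤ c * ‖Delta z‖) (hz : 0 < z.im) :
    ‖fluxPlus z‖ ≤ c * 2 := by
  refine norm_div_Delta_le hΔ hz zero_le_two ?_
  have hexp : 1 ≤ Real.exp z.im := Real.one_le_exp hz.le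
  simp only [norm_mul, Complex.norm_I, Complex.norm_ofNat, mul_one]
  nlinarith [norm_nonneg z]

lemma norm_fluxMinus_le (hΔ : (1 + ‖z‖) * Real.exp z.im ≤ c * ‖Delta z‖) (hz : 0 < z.im) :
    ‖fluxMinus z‖ ≤ c * 2 := by
  refine norm_div_Delta_le hΔ hz zero_le_two ?_
  simp only [norm_mul, Complex.norm_I, Complex.norm_ofNat, mul_one, norm_exp_neg_I_mul]
  nlinarith [Real.exp_pos z.im]

lemma norm_coefPlus_le {u : ℝ → ℝ} (hΔ : (1 + ‖z‖) * Real.exp z.im ≤ c * ‖Delta z‖)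
    (hz : 0 < z.im) (hu : ‖uHat u (I * z)‖ ≤ B)
    (hu' : ‖uHat (fun x => u (1 - x)) (I * z)‖ ≤ B) : ‖coefPlus u z‖ ≤ c * (2 * B) := by
  have hB : 0 ≤ B := (norm_nonneg _).trans hu
  have hexp : 1 ≤ Real.exp z.im := Real.one_le_exp hz.le
  refine norm_div_Delta_le hΔ hz (by positivity) ((norm_sub_le _ _).trans ?_)
  rw [norm_mul, norm_mul, norm_mul, norm_exp_neg_I_mul]
  calc ‖1 + I * z‖ * Real.exp z.im * ‖uHat u (I * z)‖
        + ‖1 - I * z‖ * ‖uHat (fun x => u (1 - x)) (I * z)‖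
      ≤ (1 + ‖z‖) * Real.exp z.im * B + (1 + ‖z‖) * B := by
        gcongr
        exacts [norm_one_add_I_mul_le z, norm_one_sub_I_mul_le z]
    _ ≤ (1 + ‖z‖) * Real.exp z.im * B + (1 + ‖z‖) * Real.exp z.im * B := by
        gcongr
        exact le_mul_of_one_le_right (by positivity) hexp
    _ = (1 + ‖z‖) * Real.exp z.im * (2 * B) := by ring

lemma norm_coefMinus_le {u : ℝ → ℝ} (hΔ : (1 + ‖z‖) * Real.exp z.im ≤ c * ‖Delta z‖)
    (hz : 0 < z.im) (hu : ‖uHat u (I * z)‖ ≤ B)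
    (hu' : ‖uHat (fun x => u (1 - x)) (I * z)‖ ≤ B) : ‖coefMinus u z‖ ≤ c * (2 * B) := by
  have hB : 0 ≤ B := (norm_nonneg _).trans hu
  have hexp : 1 ≤ Real.exp z.im := Real.one_le_exp hz.le
  refine norm_div_Delta_le hΔ hz (by positivity) ?_
  rw [norm_mul]
  calc ‖1 - I * z‖ * ‖uHat u (I * z) - Complex.exp (-(I * z)) * uHat (fun x => u (1 - x)) (I * z)‖
      ≤ (1 + ‖z‖) * (B + Real.exp z.im * B) := by
        gcongr
        · exact norm_one_sub_I_mul_le z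
        · refine (norm_sub_le _ _).trans (add_le_add hu ?_)
          rw [norm_mul, norm_exp_neg_I_mul]
          gcongr
    _ ≤ (1 + ‖z‖) * (Real.exp z.im * B + Real.exp z.im * B) := by
        gcongr
        exact le_mul_of_one_le_left hB hexp
    _ = (1 + ‖z‖) * Real.exp z.im * (2 * B) := by ring

lemma isContourMultiplier_fluxPlus : IsContourMultiplier fluxPlus where
  differentiableAt z hz := .div (by fun_prop) (differentiable_Delta z) (Delta_ne_zero hz)
  exists_norm_le a ha := by
    obtain ⟨c, hc⟩ := exists_one_add_norm_mul_exp_le_mul_norm_Delta ha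
    exact ⟨c * 2, fun z hz => norm_fluxPlus_le (hc z hz) (ha.trans_le hz)⟩

lemma isContourMultiplier_fluxMinus : IsContourMultiplier fluxMinus where
  differentiableAt z hz := .div (by fun_prop) (differentiable_Delta z) (Delta_ne_zero hz)
  exists_norm_le a ha := by
    obtain ⟨c, hc⟩ := exists_one_add_norm_mul_exp_le_mul_norm_Delta ha
    exact ⟨c * 2, fun z hz => norm_fluxMinus_le (hc z hz) (ha.trans_le hz)⟩

variable {u : ℝ → ℝ}

lemma exists_norm_uHat_and_reflection_le (hu : ContinuousOn u (Icc 0 1)) :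
    ∃ K : ℝ, ∀ z : ℂ, 0 ≤ z.im →
      ‖uHat u (I * z)‖ ≤ K ∧ ‖uHat (fun x => u (1 - x)) (I * z)‖ ≤ K := by
  obtain ⟨K, hK⟩ := exists_norm_uHat_le hu
  obtain ⟨K', hK'⟩ := exists_norm_uHat_le (continuousOn_comp_one_sub hu)
  refine ⟨max K K', fun z hz => ?_⟩
  have hre : (I * z).re ≤ 0 := by simpa using hz
  exact ⟨(hK _ hre).trans (le_max_left _ _), (hK' _ hre).trans (le_max_right _ _)⟩

lemma isContourMultiplier_coefPlus (hu : ContinuousOn u (Icc 0 1)) :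
    IsContourMultiplier (coefPlus u) where
  differentiableAt z hz := by
    have h := differentiable_uHat hu
    have h' := differentiable_uHat (continuousOn_comp_one_sub hu)
    exact .div (Differentiable.differentiableAt (by fun_prop)) (differentiable_Delta z)
      (Delta_ne_zero hz)
  exists_norm_le a ha := by
    obtain ⟨c, hc⟩ := exists_one_add_norm_mul_exp_le_mul_norm_Delta ha
    obtain ⟨K, hK⟩ := exists_norm_uHat_and_reflection_le hu
    refine ⟨c * (2 * K), fun z hz => ?_⟩
    have hz0 : 0 < z.im := ha.trans_le hz
    exact norm_coefPlus_le (hc z hz) hz0 (hK z hz0.le).1 (hK z hz0.le).2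

lemma isContourMultiplier_coefMinus (hu : ContinuousOn u (Icc 0 1)) :
    IsContourMultiplier (coefMinus u) where
  differentiableAt z hz := by
    have h := differentiable_uHat hu
    have h' := differentiable_uHat (continuousOn_comp_one_sub hu)
    exact .div (Differentiable.differentiableAt (by fun_prop)) (differentiable_Delta z)
      (Delta_ne_zero hz)
  exists_norm_le a ha := by
    obtain ⟨c, hc⟩ := exists_one_add_norm_mul_exp_le_mul_norm_Delta ha
    obtain ⟨K, hK⟩ := exists_norm_uHat_and_reflection_le hu
    refine ⟨c * (2 * K), fun z hz => ?_⟩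
    have hz0 : 0 < z.im := ha.trans_le hz
    exact norm_coefMinus_le (hc z hz) hz0 (hK z hz0.le).1 (hK z hz0.le).2

end Coefficients

section PiecewiseContinuousDeriv

lemma exists_isBounded_image_of_tendsto_deriv {E ι : Type*} [NormedAddCommGroup E]
    [NormedSpace ℝ E] {f : ℝ → E} {l : E} {F : Filter ℝ} {p : ι → Prop} {s : ι → Set ℝ}
    (hF : F.HasBasis p s) (hconvex : ∀ i, Convex ℝ (s i))
    (hbounded : ∀ i, Bornology.IsBounded (s i)) (hd : ∀ᶠ x in F, DifferentiableAt ℝ f x)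
    (hl : Tendsto (deriv f) F (𝓝 l)) : ∃ A ∈ F, Bornology.IsBounded (f '' A) := by
  have hderiv : ∀ᶠ x in F, DifferentiableAt ℝ f x ∧ ‖deriv f x‖ ≤ ‖l‖ + 1 :=
    hd.and ((hl.norm.eventually (gt_mem_nhds (lt_add_one ‖l‖))).mono fun _ hx => hx.le)
  obtain ⟨i, hi, hs⟩ := hF.eventually_iff.1 hderiv
  refine ⟨s i, hF.mem_of_mem hi, Metric.isBounded_image_iff.2
    ⟨(‖l‖ + 1) * Metric.diam (s i), fun x hx y hy => ?_⟩⟩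
  calc dist (f x) (f y) = ‖f x - f y‖ := dist_eq_norm _ _
    _ ≤ (‖l‖ + 1) * ‖x - y‖ := (hconvex i).norm_image_sub_le_of_norm_deriv_le
        (fun z hz => (hs hz).1) (fun z hz => (hs hz).2) hy hx
    _ ≤ (‖l‖ + 1) * Metric.diam (s i) := by
        rw [← dist_eq_norm]
        gcongr
        exact Metric.dist_le_diam_of_mem (hbounded i) hx hy

lemma eventually_nhdsNE_notMem_finset {X : Type*} [TopologicalSpace X] [T1Space X] (S : Finset X)
    (x : X) : ∀ᶠ y in 𝓝[≠] x, y ∉ S := by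
  classical
  have hnhds : ((S.erase x : Finset X) : Set X)ᶜ ∈ 𝓝 x :=
    (S.erase x).finite_toSet.isClosed.isOpen_compl.mem_nhds (by simp)
  filter_upwards [mem_nhdsWithin_of_mem_nhds hnhds, self_mem_nhdsWithin] with y hy hyx hyS
  exact hy (Finset.mem_coe.2 (Finset.mem_erase.2 ⟨hyx, hyS⟩))

variable {j : ℝ → ℝ} {T : ℝ}

lemma HasPiecewiseContinuousDeriv.exists_isBounded_image_nhdsGT
    (hj : HasPiecewiseContinuousDeriv j) {t : ℝ} (ht : t ∈ Ico 0 T) :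
    ∃ A ∈ 𝓝[>] t, Bornology.IsBounded (j '' A) := by
  obtain ⟨⟨S, hS⟩, hright, -⟩ := hj T (ht.1.trans_lt ht.2)
  obtain ⟨l, hl⟩ := hright t ht
  refine exists_isBounded_image_of_tendsto_deriv (nhdsGT_basis t) (convex_Ioo t)
    (Metric.isBounded_Ioo t) ?_ hl
  filter_upwards [Ioo_mem_nhdsGT ht.2, (eventually_nhdsNE_notMem_finset S t).filter_mono
    (nhdsWithin_mono _ fun s hs => ne_of_gt hs)] with s hs hsS
  exact (hS s ⟨ht.1.trans_lt hs.1, hs.2⟩ hsS).1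

lemma HasPiecewiseContinuousDeriv.exists_isBounded_image_nhdsLT
    (hj : HasPiecewiseContinuousDeriv j) {t : ℝ} (ht : t ∈ Ioc 0 T) :
    ∃ A ∈ 𝓝[<] t, Bornology.IsBounded (j '' A) := by
  obtain ⟨⟨S, hS⟩, -, hleft⟩ := hj T (ht.1.trans_le ht.2)
  obtain ⟨l, hl⟩ := hleft t ht
  refine exists_isBounded_image_of_tendsto_deriv (nhdsLT_basis t) (fun a => convex_Ioo a t)
    (fun a => Metric.isBounded_Ioo a t) ?_ hl
  filter_upwards [Ioo_mem_nhdsLT ht.1, (eventually_nhdsNE_notMem_finset S t).filter_mono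
    (nhdsWithin_mono _ fun s hs => ne_of_lt hs)] with s hs hsS
  exact (hS s ⟨hs.1, hs.2.trans_le ht.2⟩ hsS).1

lemma HasPiecewiseContinuousDeriv.isBounded_image_Icc (hj : HasPiecewiseContinuousDeriv j) :
    Bornology.IsBounded (j '' Icc 0 T) := by
  refine isCompact_Icc.induction_on (p := fun A => Bornology.IsBounded (j '' A)) (by simp)
    (fun A B hAB hB => hB.subset (image_mono hAB))
    (fun A B hA hB => by rw [image_union]; exact hA.union hB) fun t ht => ?_
  have hright : ∃ A ∈ 𝓝[Ioc t T] t, Bornology.IsBounded (j '' A) := by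
    rcases ht.2.lt_or_eq with htT | rfl
    · rw [nhdsWithin_Ioc_eq_nhdsGT htT]
      exact hj.exists_isBounded_image_nhdsGT ⟨ht.1, htT⟩
    · exact ⟨∅, by simp⟩
  have hleft : ∃ A ∈ 𝓝[Ico 0 t] t, Bornology.IsBounded (j '' A) := by
    rcases ht.1.lt_or_eq with ht0 | rfl
    · rw [nhdsWithin_Ico_eq_nhdsLT ht0]
      exact hj.exists_isBounded_image_nhdsLT ⟨ht0, ht.2⟩
    · exact ⟨∅, by simp⟩
  obtain ⟨A, hA, hjA⟩ := hright
  obtain ⟨B, hB, hjB⟩ := hleft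
  refine ⟨B ∪ ({t} ∪ A), ?_, ?_⟩
  · rw [← Ico_union_Icc_eq_Icc ht.1 ht.2, ← Ioc_insert_left ht.2, insert_eq, nhdsWithin_union,
      nhdsWithin_union]
    exact union_mem_sup hB (union_mem_sup (by simp [nhdsWithin_singleton]) hA)
  · rw [image_union, image_union, image_singleton]
    exact hjB.union (Bornology.isBounded_singleton.union hjA)

lemma HasPiecewiseContinuousDeriv.exists_abs_le (hj : HasPiecewiseContinuousDeriv j) :
    ∃ K : ℝ, ∀ s ∈ Icc 0 T, |j s| ≤ K := by
  obtain ⟨K, hK⟩ := hj.isBounded_image_Icc.exists_norm_le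
  exact ⟨K, fun s hs => hK _ (mem_image_of_mem j hs)⟩

lemma HasPiecewiseContinuousDeriv.intervalIntegrable (hj : HasPiecewiseContinuousDeriv j)
    (hT : 0 < T) : IntervalIntegrable j volume 0 T := by
  obtain ⟨K, hK⟩ := hj.exists_abs_le (T := T)
  obtain ⟨⟨S, hS⟩, -, -⟩ := hj T hT
  rw [intervalIntegrable_iff_integrableOn_Ioo_of_le hT.le]
  have hae : (Ioo 0 T \ (S : Set ℝ) : Set ℝ) =ᵐ[volume] Ioo 0 T :=
    sdiff_null_ae_eq_self (S.finite_toSet.measure_zero volume)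
  have hcont : ContinuousOn j (Ioo 0 T \ S) := fun s hs =>
    (hS s hs.1 hs.2).1.continuousAt.continuousWithinAt
  have hmeas : AEStronglyMeasurable j (volume.restrict (Ioo 0 T)) := by
    rw [← Measure.restrict_congr_set hae]
    exact hcont.aestronglyMeasurable (measurableSet_Ioo.diff S.finite_toSet.measurableSet)
  exact Integrable.of_bound hmeas K <| (ae_restrict_iff' measurableSet_Ioo).2 <|
    ae_of_all _ fun s hs => hK s (Ioo_subset_Icc_self hs)

end PiecewiseContinuousDeriv

section BoundaryKernel

/-- The contribution `∫₀ᵗ e^{-z²(t-s)} j(s) ds` of the boundary data to the integrands. -/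
def duhamel (j : ℝ → ℝ) (t : ℝ) (z : ℂ) : ℂ :=
  Complex.exp (-(z ^ 2 * t)) * jHat j (z ^ 2) t

/-- The common form of the integrands on `∂D₊` (with `y = x`) and, after the reflection `z ↦ -z`, on
`∂D₋` (with `y = 1 - x`): `y` is the distance of `x` to the endpoint that the contour belongs to. -/
def boundaryKernel (M N : ℂ → ℂ) (j : ℝ → ℝ) (y t : ℝ) (z : ℂ) : ℂ :=
  Complex.exp (I * z * y) * (Complex.exp (-(z ^ 2 * t)) * M z + N z * duhamel j t z)

variable {M N : ℂ → ℂ} {j : ℝ → ℝ} {t K : ℝ}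

lemma differentiable_duhamel (hj : IntervalIntegrable j volume 0 t) :
    Differentiable ℂ (duhamel j t) := by
  have hjHat : Differentiable ℂ fun z : ℂ => jHat j z t :=
    differentiable_integral_exp_mul (f := fun s => (j s : ℂ)) ⟨hj.1.ofReal, hj.2.ofReal⟩
  have hsq : Differentiable ℂ fun z : ℂ => jHat j (z ^ 2) t := hjHat.comp (differentiable_id.pow 2)
  unfold duhamel
  fun_prop

lemma differentiableAt_boundaryKernel (hM : IsContourMultiplier M) (hN : IsContourMultiplier N)
    (hj : IntervalIntegrable j volume 0 t) {y : ℝ} {z : ℂ} (hz : 0 < z.im) :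
    DifferentiableAt ℂ (boundaryKernel M N j y t) z := by
  have hMz := hM.differentiableAt z hz
  have hNz := hN.differentiableAt z hz
  have hjz := differentiable_duhamel hj z
  unfold boundaryKernel
  fun_prop

lemma integral_exp_neg_mul_le {κ : ℝ} (hκ : 0 ≤ κ) (ht : 0 ≤ t) :
    ∫ τ in (0 : ℝ)..t, Real.exp (-(κ * τ)) ≤ 2 * t / (1 + t * κ) := by
  have hle : ∫ τ in (0 : ℝ)..t, Real.exp (-(κ * τ)) ≤ t := by
    calc ∫ τ in (0 : ℝ)..t, Real.exp (-(κ * τ)) ≤ ∫ _ in (0 : ℝ)..t, (1 : ℝ) := by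
          refine intervalIntegral.integral_mono_on ht
            (Continuous.intervalIntegrable (by fun_prop) _ _) intervalIntegrable_const
            fun τ hτ => ?_
          simpa using mul_nonneg hκ hτ.1
      _ = t := by simp
  have hmul : κ * ∫ τ in (0 : ℝ)..t, Real.exp (-(κ * τ)) ≤ 1 := by
    rw [intervalIntegral.mul_integral_comp_mul_left (f := fun x => Real.exp (-x)),
      intervalIntegral.integral_comp_neg (f := Real.exp), integral_exp]
    simpa using (Real.exp_pos _).le
  rw [le_div_iff₀ (by positivity)]
  nlinarith

lemma duhamel_eq_integral (j : ℝ → ℝ) (t : ℝ) (z : ℂ) :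
    duhamel j t z = ∫ s in (0 : ℝ)..t, Complex.exp (-(z ^ 2 * (t - s : ℝ))) * (j s : ℂ) := by
  rw [duhamel, jHat, ← intervalIntegral.integral_const_mul]
  refine intervalIntegral.integral_congr fun s _ => ?_
  rw [← mul_assoc, ← Complex.exp_add]
  congr 2
  push_cast
  ring

lemma mul_norm_duhamel_le {E A κ : ℝ} {z : ℂ} (ht : 0 ≤ t) (hκ : 0 ≤ κ) (hA : 0 ≤ A) (hE : 0 ≤ E)
    (hK : ∀ s ∈ Icc 0 t, |j s| ≤ K)
    (hexp : ∀ τ ∈ Icc 0 t, E * Real.exp (-((z ^ 2).re * τ)) ≤ A * Real.exp (-(κ * τ))) :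
    E * ‖duhamel j t z‖ ≤ A * K * (2 * t / (1 + t * κ)) := by
  have hK0 : 0 ≤ K := (abs_nonneg _).trans (hK 0 ⟨le_rfl, ht⟩)
  have hpoint : ∀ s ∈ Ioc 0 t, ‖(E : ℂ) * (Complex.exp (-(z ^ 2 * (t - s : ℝ))) * (j s : ℂ))‖
      ≤ A * K * Real.exp (-(κ * (t - s))) := by
    intro s hs
    rw [norm_mul, norm_mul, Complex.norm_real, Complex.norm_real, Real.norm_of_nonneg hE,
      Complex.norm_exp, Complex.neg_re, Complex.re_mul_ofReal, Real.norm_eq_abs, ← mul_assoc,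
      mul_right_comm A]
    exact mul_le_mul (hexp (t - s) ⟨sub_nonneg.2 hs.2, sub_le_self _ hs.1.le⟩)
      (hK s (Ioc_subset_Icc_self hs)) (abs_nonneg _) (by positivity)
  calc E * ‖duhamel j t z‖
      = ‖∫ s in (0 : ℝ)..t, (E : ℂ) * (Complex.exp (-(z ^ 2 * (t - s : ℝ))) * (j s : ℂ))‖ := by
        rw [intervalIntegral.integral_const_mul, ← duhamel_eq_integral, norm_mul,
          Complex.norm_real, Real.norm_of_nonneg hE]
    _ ≤ ∫ s in (0 : ℝ)..t, A * K * Real.exp (-(κ * (t - s))) :=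
        intervalIntegral.norm_integral_le_of_norm_le ht (ae_of_all _ hpoint)
          (Continuous.intervalIntegrable (by fun_prop) _ _)
    _ = A * K * ∫ τ in (0 : ℝ)..t, Real.exp (-(κ * τ)) := by
        rw [intervalIntegral.integral_const_mul,
          intervalIntegral.integral_comp_sub_left (fun τ => Real.exp (-(κ * τ))), sub_self,
          sub_zero]
    _ ≤ A * K * (2 * t / (1 + t * κ)) := by
        gcongr
        exact integral_exp_neg_mul_le hκ ht

lemma norm_boundaryKernel_le {y A C κ : ℝ} {z : ℂ} (ht : 0 ≤ t) (hκ : 0 ≤ κ) (hA : 0 ≤ A)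
    (hK : ∀ s ∈ Icc 0 t, |j s| ≤ K) (hM : ‖M z‖ ≤ C) (hN : ‖N z‖ ≤ C)
    (hexp : ∀ τ ∈ Icc 0 t, ‖Complex.exp (I * z * y)‖ * Real.exp (-((z ^ 2).re * τ))
      ≤ A * Real.exp (-(κ * τ))) :
    ‖boundaryKernel M N j y t z‖ ≤ C * A * (1 + 2 * K * t) / (1 + t * κ) := by
  have hC : 0 ≤ C := (norm_nonneg _).trans hM
  have hdecay : Real.exp (-(κ * t)) ≤ 1 / (1 + t * κ) := by
    rw [Real.exp_neg, ← one_div, mul_comm κ]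
    exact one_div_le_one_div_of_le (by positivity) (by linarith [Real.add_one_le_exp (t * κ)])
  have hinitial : ‖Complex.exp (I * z * y)‖ * ‖Complex.exp (-(z ^ 2 * t)) * M z‖
      ≤ A * (1 / (1 + t * κ)) * C := by
    rw [norm_mul, ← mul_assoc, Complex.norm_exp (-_), Complex.neg_re, Complex.re_mul_ofReal]
    exact mul_le_mul ((hexp t ⟨ht, le_rfl⟩).trans (by gcongr)) hM (norm_nonneg _) (by positivity)
  have hflux : ‖Complex.exp (I * z * y)‖ * ‖N z * duhamel j t z‖
      ≤ C * (A * K * (2 * t / (1 + t * κ))) := by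
    rw [norm_mul, mul_left_comm]
    exact mul_le_mul hN (mul_norm_duhamel_le ht hκ hA (norm_nonneg _) hK hexp) (by positivity) hC
  calc ‖boundaryKernel M N j y t z‖
      ≤ A * (1 / (1 + t * κ)) * C + C * (A * K * (2 * t / (1 + t * κ))) := by
        rw [boundaryKernel, norm_mul]
        exact (mul_le_mul_of_nonneg_left (norm_add_le _ _) (norm_nonneg _)).trans
          ((mul_add _ _ _).trans_le (add_le_add hinitial hflux))
    _ = C * A * (1 + 2 * K * t) / (1 + t * κ) := by ring

lemma one_div_one_add_mul_sq_le {m : ℝ} (hm : 0 < m) (r : ℝ) :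
    1 / (1 + m * r ^ 2) ≤ (1 + 1 / m) / (1 + r ^ 2) := by
  have hexpand : (1 + 1 / m) * (1 + m * r ^ 2) = 1 + r ^ 2 + 1 / m + m * r ^ 2 := by
    field_simp
    ring
  have := one_div_pos.2 hm
  rw [div_le_div_iff₀ (by positivity) (by positivity), hexpand]
  nlinarith [sq_nonneg r]

lemma IsContourMultiplier.exists_norm_le_and_norm_le (hM : IsContourMultiplier M)
    (hN : IsContourMultiplier N) {a : ℝ} (ha : 0 < a) :
    ∃ C : ℝ, 0 ≤ C ∧ ∀ z : ℂ, a ≤ z.im → ‖M z‖ ≤ C ∧ ‖N z‖ ≤ C := by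
  obtain ⟨C₁, hC₁⟩ := hM.exists_norm_le a ha
  obtain ⟨C₂, hC₂⟩ := hN.exists_norm_le a ha
  have hle : ∀ z : ℂ, a ≤ z.im → ‖M z‖ ≤ max C₁ C₂ ∧ ‖N z‖ ≤ max C₁ C₂ := fun z hz =>
    ⟨(hC₁ z hz).trans (le_max_left _ _), (hC₂ z hz).trans (le_max_right _ _)⟩
  exact ⟨max C₁ C₂, (norm_nonneg _).trans (hle (a * I) (by simp)).1, hle⟩

lemma exists_norm_boundaryKernel_strip_le (hM : IsContourMultiplier M)
    (hN : IsContourMultiplier N) (ht : 0 < t) (hK : ∀ s ∈ Icc 0 t, |j s| ≤ K) {a : ℝ}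
    (ha : 0 < a) (b : ℝ) :
    ∃ C : ℝ, ∀ y : ℝ, 0 ≤ y → ∀ x v : ℝ, v ∈ Icc a b →
      ‖boundaryKernel M N j y t (x + v * I)‖ ≤ C / (1 + x ^ 2) := by
  obtain ⟨C, hC0, hC⟩ := hM.exists_norm_le_and_norm_le hN ha
  have hK0 : 0 ≤ K := (abs_nonneg _).trans (hK 0 ⟨le_rfl, ht.le⟩)
  refine ⟨C * Real.exp (b ^ 2 * t) * (1 + 2 * K * t) * (1 + 1 / t), fun y hy x v hv => ?_⟩
  have hv0 : 0 ≤ v := ha.le.trans hv.1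
  have hre : ((x + v * I : ℂ) ^ 2).re = x ^ 2 - v ^ 2 := by
    simp [pow_two]
  have hexp : ∀ τ ∈ Icc 0 t,
      ‖Complex.exp (I * (x + v * I) * y)‖ * Real.exp (-(((x + v * I : ℂ) ^ 2).re * τ))
        ≤ Real.exp (b ^ 2 * t) * Real.exp (-(x ^ 2 * τ)) := by
    intro τ hτ
    have hvb : v ^ 2 * τ ≤ b ^ 2 * t := by
      have := hv.2
      have := hτ.1
      have := hτ.2
      gcongr
    have hIre : (I * (x + v * I) * y).re = -(v * y) := by simp
    rw [Complex.norm_exp, hre, hIre, ← Real.exp_add, ← Real.exp_add, Real.exp_le_exp]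
    nlinarith [mul_nonneg hv0 hy]
  have hz := hC (x + v * I) (by simpa using hv.1)
  calc ‖boundaryKernel M N j y t (x + v * I)‖
      ≤ C * Real.exp (b ^ 2 * t) * (1 + 2 * K * t) / (1 + t * x ^ 2) :=
        norm_boundaryKernel_le ht.le (sq_nonneg x) (Real.exp_pos _).le hK hz.1 hz.2 hexp
    _ = C * Real.exp (b ^ 2 * t) * (1 + 2 * K * t) * (1 / (1 + t * x ^ 2)) := by ring
    _ ≤ C * Real.exp (b ^ 2 * t) * (1 + 2 * K * t) * ((1 + 1 / t) / (1 + x ^ 2)) := by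
        exact mul_le_mul_of_nonneg_left (one_div_one_add_mul_sq_le ht x) (by positivity)
    _ = _ := by ring

variable {y ε θ : ℝ}

lemma ray_im (ε r θ : ℝ) : (ε * I + r * Complex.exp (θ * I)).im = ε + r * Real.sin θ := by
  simp [Complex.exp_im]

lemma ray_sq_re (ε r θ : ℝ) :
    ((ε * I + r * Complex.exp (θ * I)) ^ 2).re
      = r ^ 2 * (1 - 2 * Real.sin θ ^ 2) - 2 * ε * r * Real.sin θ - ε ^ 2 := by
  have hre : (ε * I + r * Complex.exp (θ * I)).re = r * Real.cos θ := by
    simp [Complex.exp_re]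
  rw [pow_two, Complex.mul_re, ray_im, hre]
  linear_combination r ^ 2 * Real.sin_sq_add_cos_sq θ

lemma exp_neg_mul_div_le {δ s r : ℝ} (hδ : 0 < δ) (ht : 0 < t) (hr : 0 ≤ r) (hs : 0 ≤ s)
    (hs' : s ^ 2 ≤ 1 / 2) :
    Real.exp (-(δ * (r * s))) / (1 + t * (r ^ 2 * (1 - 2 * s ^ 2)))
      ≤ (1 + 1 / min (δ ^ 2 / 4) t) / (1 + r ^ 2) := by
  set m := min (δ ^ 2 / 4) t
  have hm : 0 < m := lt_min (by positivity) ht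
  have hcos : 0 ≤ 1 - 2 * s ^ 2 := by linarith
  have hquad : 1 + (δ * (r * s)) ^ 2 / 2 ≤ Real.exp (δ * (r * s)) := by
    have := Real.quadratic_le_exp_of_nonneg (x := δ * (r * s)) (by positivity)
    nlinarith [show 0 ≤ δ * (r * s) by positivity]
  -- `m` is at most the average of `δ² / 4` and `t` with weights `2s²` and `1 - 2s²`.
  have hm_le : m ≤ 2 * s ^ 2 * (δ ^ 2 / 4) + (1 - 2 * s ^ 2) * t :=
    calc m = 2 * s ^ 2 * m + (1 - 2 * s ^ 2) * m := by ring
      _ ≤ _ := by gcongr; exacts [min_le_left _ _, min_le_right _ _]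
  refine le_trans ?_ (one_div_one_add_mul_sq_le hm r)
  rw [Real.exp_neg, inv_eq_one_div, div_div]
  refine one_div_le_one_div_of_le (by positivity) ?_
  calc 1 + m * r ^ 2 ≤ 1 + (2 * s ^ 2 * (δ ^ 2 / 4) + (1 - 2 * s ^ 2) * t) * r ^ 2 := by gcongr
    _ = 1 + (δ * (r * s)) ^ 2 / 2 + t * (r ^ 2 * (1 - 2 * s ^ 2)) := by ring
    _ ≤ (1 + (δ * (r * s)) ^ 2 / 2) * (1 + t * (r ^ 2 * (1 - 2 * s ^ 2))) := by
        have : 0 ≤ (δ * (r * s)) ^ 2 / 2 * (t * (r ^ 2 * (1 - 2 * s ^ 2))) := by positivity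
        linarith
    _ ≤ Real.exp (δ * (r * s)) * (1 + t * (r ^ 2 * (1 - 2 * s ^ 2))) := by gcongr

lemma norm_exp_mul_exp_ray_le {r τ : ℝ} (hε : 0 < ε) (hy : 0 ≤ y) (hr : 0 ≤ r)
    (hθ : 0 ≤ Real.sin θ) (hτ : τ ∈ Icc 0 t) :
    ‖Complex.exp (I * (ε * I + r * Complex.exp (θ * I)) * y)‖
        * Real.exp (-(((ε * I + r * Complex.exp (θ * I)) ^ 2).re * τ))
      ≤ Real.exp (ε ^ 2 * t) * Real.exp (-((y - 2 * ε * t) * (r * Real.sin θ)))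
        * Real.exp (-(r ^ 2 * (1 - 2 * Real.sin θ ^ 2) * τ)) := by
  have hrs : 0 ≤ r * Real.sin θ := mul_nonneg hr hθ
  have hlin : ε * (r * Real.sin θ) * τ ≤ ε * (r * Real.sin θ) * t :=
    mul_le_mul_of_nonneg_left hτ.2 (mul_nonneg hε.le hrs)
  have hconst : ε ^ 2 * τ ≤ ε ^ 2 * t := mul_le_mul_of_nonneg_left hτ.2 (sq_nonneg ε)
  rw [Complex.norm_exp, Complex.re_mul_ofReal, Complex.I_mul_re, ray_im, ray_sq_re,
    ← Real.exp_add, ← Real.exp_add, ← Real.exp_add, Real.exp_le_exp]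
  nlinarith [mul_nonneg hε.le hy]

lemma exists_norm_boundaryKernel_ray_le (hM : IsContourMultiplier M) (hN : IsContourMultiplier N)
    (ht : 0 < t) (hK : ∀ s ∈ Icc 0 t, |j s| ≤ K) (hε : 0 < ε) (hy : 2 * ε * t < y) :
    ∃ C : ℝ, ∀ θ : ℝ, 0 ≤ Real.sin θ → Real.sin θ ^ 2 ≤ 1 / 2 → ∀ r : ℝ, 0 < r →
      ‖boundaryKernel M N j y t (ε * I + r * Complex.exp (θ * I))‖ ≤ C / (1 + r ^ 2) := by
  obtain ⟨C, hC0, hC⟩ := hM.exists_norm_le_and_norm_le hN hε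
  have hK0 : 0 ≤ K := (abs_nonneg _).trans (hK 0 ⟨le_rfl, ht.le⟩)
  have hy0 : 0 < y := lt_trans (by positivity) hy
  set B := C * Real.exp (ε ^ 2 * t) * (1 + 2 * K * t)
  refine ⟨B * (1 + 1 / min ((y - 2 * ε * t) ^ 2 / 4) t), fun θ hs hs' r hr => ?_⟩
  have hz := hC (ε * I + r * Complex.exp (θ * I)) (by
    rw [ray_im]
    exact le_add_of_nonneg_right (mul_nonneg hr.le hs))
  set D := Real.exp (-((y - 2 * ε * t) * (r * Real.sin θ)))
  have hκ : 0 ≤ r ^ 2 * (1 - 2 * Real.sin θ ^ 2) := mul_nonneg (sq_nonneg r) (by linarith)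
  calc ‖boundaryKernel M N j y t (ε * I + r * Complex.exp (θ * I))‖
      ≤ C * (Real.exp (ε ^ 2 * t) * D) * (1 + 2 * K * t)
          / (1 + t * (r ^ 2 * (1 - 2 * Real.sin θ ^ 2))) :=
        norm_boundaryKernel_le ht.le hκ (by positivity) hK hz.1 hz.2
          fun τ hτ => norm_exp_mul_exp_ray_le hε hy0.le hr.le hs hτ
    _ = B * (D / (1 + t * (r ^ 2 * (1 - 2 * Real.sin θ ^ 2)))) := by ring
    _ ≤ B * ((1 + 1 / min ((y - 2 * ε * t) ^ 2 / 4) t) / (1 + r ^ 2)) := by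
        exact mul_le_mul_of_nonneg_left (exp_neg_mul_div_le (sub_pos.2 hy) ht hr.le hs hs')
          (by positivity)
    _ = _ := by ring

lemma sin_nonneg_and_sq_le_half_of_le_pi_div_four (hθ : θ ∈ Icc 0 (π / 4)) :
    0 ≤ Real.sin θ ∧ Real.sin θ ^ 2 ≤ 1 / 2 := by
  have hcos : 0 ≤ Real.cos (2 * θ) :=
    Real.cos_nonneg_of_mem_Icc ⟨by linarith [hθ.1, Real.pi_pos], by linarith [hθ.2]⟩
  have := Real.cos_two_mul θ
  exact ⟨Real.sin_nonneg_of_nonneg_of_le_pi hθ.1 (by linarith [hθ.2, Real.pi_pos]),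
    by linarith [Real.sin_sq_add_cos_sq θ]⟩

lemma sin_nonneg_and_sq_le_half_of_three_pi_div_four_le (hθ : θ ∈ Icc (3 * π / 4) π) :
    0 ≤ Real.sin θ ∧ Real.sin θ ^ 2 ≤ 1 / 2 := by
  rw [← Real.sin_pi_sub]
  exact sin_nonneg_and_sq_le_half_of_le_pi_div_four ⟨by linarith [hθ.2], by linarith [hθ.1]⟩

lemma differentiableAt_boundaryKernel_ray (hM : IsContourMultiplier M)
    (hN : IsContourMultiplier N) (hj : IntervalIntegrable j volume 0 t) (hε : 0 < ε)
    (hθ : 0 ≤ Real.sin θ) {r : ℝ} (hr : 0 < r) :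
    DifferentiableAt ℂ (boundaryKernel M N j y t) (ε * I + r * Complex.exp (θ * I)) := by
  refine differentiableAt_boundaryKernel hM hN hj ?_
  rw [ray_im]
  positivity

lemma integrable_boundaryKernel (hM : IsContourMultiplier M) (hN : IsContourMultiplier N)
    (ht : 0 < t) (hK : ∀ s ∈ Icc 0 t, |j s| ≤ K) (hj : IntervalIntegrable j volume 0 t)
    (hy : 0 ≤ y) {v : ℝ} (hv : 0 < v) :
    Integrable fun x : ℝ => boundaryKernel M N j y t (x + v * I) := by
  obtain ⟨C, hC⟩ := exists_norm_boundaryKernel_strip_le hM hN ht hK hv v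
  refine integrable_horizontalLine (fun z hz => ?_) fun x => hC y hy x v ⟨le_rfl, le_rfl⟩
  exact (differentiableAt_boundaryKernel hM hN hj (hz ▸ hv)).continuousAt

lemma integral_boundaryKernel_eq_of_le (hM : IsContourMultiplier M) (hN : IsContourMultiplier N)
    (ht : 0 < t) (hK : ∀ s ∈ Icc 0 t, |j s| ≤ K) (hj : IntervalIntegrable j volume 0 t)
    (hy : 0 ≤ y) {a b : ℝ} (ha : 0 < a) (hab : a ≤ b) :
    ∫ x : ℝ, boundaryKernel M N j y t (x + a * I)
      = ∫ x : ℝ, boundaryKernel M N j y t (x + b * I) := by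
  obtain ⟨C, hC⟩ := exists_norm_boundaryKernel_strip_le hM hN ht hK ha b
  exact integral_horizontalLine_eq hab
    (fun z hz => differentiableAt_boundaryKernel hM hN hj (ha.trans_le hz.1)) (hC y hy)

lemma rayIntegrable_boundaryKernel (hM : IsContourMultiplier M) (hN : IsContourMultiplier N)
    (ht : 0 < t) (hK : ∀ s ∈ Icc 0 t, |j s| ≤ K) (hj : IntervalIntegrable j volume 0 t)
    (hε : 0 < ε) (hy : 2 * ε * t < y) (hθ : 0 ≤ Real.sin θ ∧ Real.sin θ ^ 2 ≤ 1 / 2) :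
    RayIntegrable (boundaryKernel M N j y t) (ε * I) θ := by
  obtain ⟨C, hC⟩ := exists_norm_boundaryKernel_ray_le hM hN ht hK hε hy
  exact rayIntegrable_of_norm_le
    (fun r hr => (differentiableAt_boundaryKernel_ray hM hN hj hε hθ.1 hr).continuousAt)
    (hC θ hθ.1 hθ.2)

lemma integralDPlus_boundaryKernel (hM : IsContourMultiplier M) (hN : IsContourMultiplier N)
    (ht : 0 < t) (hK : ∀ s ∈ Icc 0 t, |j s| ≤ K) (hj : IntervalIntegrable j volume 0 t)
    (hε : 0 < ε) (hy : 2 * ε * t < y) :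
    integralDPlus ε (boundaryKernel M N j y t)
      = ∫ x : ℝ, boundaryKernel M N j y t (x + (1 : ℝ) * I) := by
  obtain ⟨C, hC⟩ := exists_norm_boundaryKernel_ray_le hM hN ht hK hε hy
  have hy0 : 0 ≤ y := le_trans (by positivity) hy.le
  have hrotate : ∀ α β : ℝ, α ≤ β →
      (∀ θ ∈ Icc α β, 0 ≤ Real.sin θ ∧ Real.sin θ ^ 2 ≤ 1 / 2) →
      rayIntegral (boundaryKernel M N j y t) (ε * I) α
        = rayIntegral (boundaryKernel M N j y t) (ε * I) β := fun α β hαβ hsin =>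
    rayIntegral_eq_of_norm_le hαβ
      (fun θ hθ r hr => differentiableAt_boundaryKernel_ray hM hN hj hε (hsin θ hθ).1 hr)
      (fun θ hθ => hC θ (hsin θ hθ).1 (hsin θ hθ).2)
  have hpi := Real.pi_pos
  calc integralDPlus ε (boundaryKernel M N j y t)
      = rayIntegral (boundaryKernel M N j y t) (ε * I) 0
          - rayIntegral (boundaryKernel M N j y t) (ε * I) π := by
        rw [integralDPlus, sectorBoundaryIntegral,
          hrotate 0 (π / 4) (by positivity)
            fun θ hθ => sin_nonneg_and_sq_le_half_of_le_pi_div_four hθ,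
          hrotate (3 * π / 4) π (by linarith)
            fun θ hθ => sin_nonneg_and_sq_le_half_of_three_pi_div_four_le hθ]
    _ = ∫ x : ℝ, boundaryKernel M N j y t (x + ε * I) :=
        rayIntegral_zero_sub_rayIntegral_pi (integrable_boundaryKernel hM hN ht hK hj hy0 hε)
    _ = ∫ x : ℝ, boundaryKernel M N j y t (x + (1 : ℝ) * I) := by
        rcases le_total ε 1 with h | h
        · exact integral_boundaryKernel_eq_of_le hM hN ht hK hj hy0 hε h
        · exact (integral_boundaryKernel_eq_of_le hM hN ht hK hj hy0 one_pos h).symm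

end BoundaryKernel

section LineSolution

variable {u j : ℝ → ℝ} {t K : ℝ}

lemma elem_eq_exp_mul_exp (x t : ℝ) (z : ℂ) :
    elem x t z = Complex.exp (I * z * x) * Complex.exp (-(z ^ 2 * t)) := by
  rw [elem, ← Complex.exp_add, sub_eq_add_neg]

lemma integrandPlus_eq_boundaryKernel (u j : ℝ → ℝ) (x t : ℝ) :
    integrandPlus u j x t = boundaryKernel (coefPlus u) fluxPlus j x t := by
  ext z
  rw [integrandPlus, boundaryKernel, elem_eq_exp_mul_exp, coefPlus, fluxPlus, duhamel, mu0,
    ← exp_mul_uHat_neg]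
  ring

lemma mu1_neg (u j : ℝ → ℝ) (t : ℝ) (z : ℂ) :
    mu1 u j t (-z) = -((1 - I * z) * Complex.exp (I * z) * (uHat u (I * z) - uHat u (-(I * z)))
      + 2 * I * z * jHat j (z ^ 2) t) := by
  rw [mu1, mu0, Delta_neg, Delta]
  simp only [mul_neg, neg_neg, neg_sq]
  ring

lemma integrandMinus_neg_eq_boundaryKernel (u j : ℝ → ℝ) (x t : ℝ) :
    (fun z => integrandMinus u j x t (-z))
      = boundaryKernel (coefMinus u) fluxMinus j (1 - x) t := by
  ext z
  have hexp : Complex.exp (I * z * (1 - x : ℝ))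
      = Complex.exp (I * z) * Complex.exp (I * -z * x) := by
    rw [← Complex.exp_add]
    congr 1
    push_cast
    ring
  have hinv : Complex.exp (I * z) * Complex.exp (-(I * z)) = 1 := by
    rw [← Complex.exp_add, add_neg_cancel, Complex.exp_zero]
  rw [integrandMinus, boundaryKernel, elem_eq_exp_mul_exp, Delta_neg, mu1_neg, coefMinus,
    fluxMinus, duhamel, hexp, neg_sq, div_mul_eq_mul_div, mul_neg, neg_div_neg_eq,
    ← exp_mul_uHat_neg]
  simp only [div_eq_mul_inv]
  linear_combination (Complex.exp (I * -z * x) * (Delta z)⁻¹ * Complex.exp (-(z ^ 2 * t))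
    * ((1 - I * z) * Complex.exp (I * z) * uHat u (-(I * z))
      - 2 * I * z * jHat j (z ^ 2) t)) * hinv

lemma norm_integrandReal_le {U : ℝ} (hU : ∀ w : ℂ, w.re ≤ 0 → ‖uHat u w‖ ≤ U) (x t l : ℝ) :
    ‖integrandReal u x t l‖ ≤ U * Real.exp (-t * l ^ 2) := by
  have hgauss : ‖Complex.exp (-((l : ℂ) ^ 2 * t))‖ = Real.exp (-t * l ^ 2) := by
    rw [← Complex.ofReal_pow, ← Complex.ofReal_mul, ← Complex.ofReal_neg,
      Complex.norm_exp_ofReal]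
    congr 1
    ring
  have hU' : ‖uHat u (-(I * l))‖ ≤ U := hU _ (by simp)
  have hunit : ‖Complex.exp (I * l * x)‖ = 1 := by
    simp [Complex.norm_exp]
  rw [integrandReal, elem_eq_exp_mul_exp, norm_mul, norm_mul, hgauss, hunit, one_mul, mul_comm]
  gcongr

lemma integrable_integrandReal (hu : ContinuousOn u (Icc 0 1)) (x : ℝ) (ht : 0 < t) :
    Integrable fun l : ℝ => integrandReal u x t l := by
  obtain ⟨U, hU⟩ := exists_norm_uHat_le hu
  have hcont : Continuous fun l : ℝ => integrandReal u x t l := by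
    have := (differentiable_uHat hu).continuous
    unfold integrandReal elem
    fun_prop
  exact ((integrable_exp_neg_mul_sq ht).const_mul U).mono' hcont.aestronglyMeasurable
    (ae_of_all _ fun l => norm_integrandReal_le hU x t l)

lemma continuous_integral_integrandReal (hu : ContinuousOn u (Icc 0 1)) (ht : 0 < t) :
    Continuous fun x : ℝ => ∫ l : ℝ, integrandReal u x t l := by
  obtain ⟨U, hU⟩ := exists_norm_uHat_le hu
  refine continuous_of_dominated (bound := fun l => U * Real.exp (-t * l ^ 2))
    (fun x => (integrable_integrandReal hu x ht).aestronglyMeasurable)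
    (fun x => ae_of_all _ fun l => norm_integrandReal_le hU x t l)
    ((integrable_exp_neg_mul_sq ht).const_mul U) (ae_of_all _ fun l => ?_)
  unfold integrandReal elem
  fun_prop

/-- The integral of the boundary kernel over the line `Im z = 1`, to which `∂D₊` can be moved. -/
def boundaryIntegral (M N : ℂ → ℂ) (j : ℝ → ℝ) (y t : ℝ) : ℂ :=
  ∫ x : ℝ, boundaryKernel M N j y t (x + (1 : ℝ) * I)

lemma continuousOn_boundaryIntegral {M N : ℂ → ℂ} (hM : IsContourMultiplier M)
    (hN : IsContourMultiplier N) (ht : 0 < t) (hK : ∀ s ∈ Icc 0 t, |j s| ≤ K)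
    (hj : IntervalIntegrable j volume 0 t) :
    ContinuousOn (fun y => boundaryIntegral M N j y t) (Ici 0) := by
  obtain ⟨C, hC⟩ := exists_norm_boundaryKernel_strip_le hM hN ht hK one_pos 1
  refine continuousOn_of_dominated (bound := fun x => C / (1 + x ^ 2))
    (fun y hy => (integrable_boundaryKernel hM hN ht hK hj hy one_pos).aestronglyMeasurable)
    (fun y hy => ae_of_all _ fun x => hC y hy x 1 ⟨le_rfl, le_rfl⟩)
    (integrable_const_div_one_add_sq C) (ae_of_all _ fun x => Continuous.continuousOn ?_)
  unfold boundaryKernel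
  fun_prop

/-- The solution of the initial-boundary value problem, with the contours `∂D₊` and `∂D₋` of the
integral representation replaced by the lines `Im z = 1` and `Im z = -1`; unlike the representation,
it makes sense for `x = 0` and `x = 1` too. -/
def lineSolution (u j : ℝ → ℝ) (x t : ℝ) : ℂ :=
  1 / (2 * (π : ℂ)) * ((∫ l : ℝ, integrandReal u x t l)
    - boundaryIntegral (coefPlus u) fluxPlus j x t
    + boundaryIntegral (coefMinus u) fluxMinus j (1 - x) t)

lemma continuousOn_lineSolution (hu : ContinuousOn u (Icc 0 1)) (ht : 0 < t)
    (hK : ∀ s ∈ Icc 0 t, |j s| ≤ K) (hj : IntervalIntegrable j volume 0 t) :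
    ContinuousOn (fun x => lineSolution u j x t) (Icc 0 1) := by
  have hplus : ContinuousOn (fun x => boundaryIntegral (coefPlus u) fluxPlus j x t) (Icc 0 1) :=
    (continuousOn_boundaryIntegral (isContourMultiplier_coefPlus hu)
      isContourMultiplier_fluxPlus ht hK hj).mono fun x hx => hx.1
  have hminus : ContinuousOn (fun x => boundaryIntegral (coefMinus u) fluxMinus j (1 - x) t)
      (Icc 0 1) :=
    (continuousOn_boundaryIntegral (isContourMultiplier_coefMinus hu)
      isContourMultiplier_fluxMinus ht hK hj).comp (f := fun x : ℝ => 1 - x) (by fun_prop)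
      fun x hx => sub_nonneg.2 hx.2
  exact continuousOn_const.mul
    (((continuous_integral_integrandReal hu ht).continuousOn.sub hplus).add hminus)

lemma representationConverges_of_bounded {ε x : ℝ} (hu : ContinuousOn u (Icc 0 1)) (ht : 0 < t)
    (hK : ∀ s ∈ Icc 0 t, |j s| ≤ K) (hj : IntervalIntegrable j volume 0 t) (hε : 0 < ε)
    (hx : 2 * ε * t < x) (hx' : 2 * ε * t < 1 - x) : RepresentationConverges u j ε x t := by
  have hpi := Real.pi_pos
  have hright := sin_nonneg_and_sq_le_half_of_le_pi_div_four (θ := π / 4) ⟨by positivity, le_rfl⟩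
  have hleft := sin_nonneg_and_sq_le_half_of_three_pi_div_four_le (θ := 3 * π / 4)
    ⟨le_rfl, by linarith⟩
  refine ⟨integrable_integrandReal hu x ht, ?_, ?_, ?_, ?_⟩
  rotate_left 2
  · rw [show 5 * π / 4 = π + π / 4 by ring, rayIntegrable_neg_pi_add_iff,
      integrandMinus_neg_eq_boundaryKernel]
    exact rayIntegrable_boundaryKernel (isContourMultiplier_coefMinus hu)
      isContourMultiplier_fluxMinus ht hK hj hε hx' hright
  · rw [show 7 * π / 4 = π + 3 * π / 4 by ring, rayIntegrable_neg_pi_add_iff,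
      integrandMinus_neg_eq_boundaryKernel]
    exact rayIntegrable_boundaryKernel (isContourMultiplier_coefMinus hu)
      isContourMultiplier_fluxMinus ht hK hj hε hx' hleft
  all_goals
    rw [integrandPlus_eq_boundaryKernel]
    exact rayIntegrable_boundaryKernel (isContourMultiplier_coefPlus hu)
      isContourMultiplier_fluxPlus ht hK hj hε hx ‹_›

lemma lineSolution_eq_representation {ε x : ℝ} (hu : ContinuousOn u (Icc 0 1)) (ht : 0 < t)
    (hK : ∀ s ∈ Icc 0 t, |j s| ≤ K) (hj : IntervalIntegrable j volume 0 t) (hε : 0 < ε)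
    (hx : 2 * ε * t < x) (hx' : 2 * ε * t < 1 - x) :
    lineSolution u j x t = representation u j ε x t := by
  rw [representation, integralDMinus_eq_neg_integralDPlus, integrandPlus_eq_boundaryKernel,
    integrandMinus_neg_eq_boundaryKernel,
    integralDPlus_boundaryKernel (isContourMultiplier_coefPlus hu) isContourMultiplier_fluxPlus
      ht hK hj hε hx,
    integralDPlus_boundaryKernel (isContourMultiplier_coefMinus hu) isContourMultiplier_fluxMinus
      ht hK hj hε hx', sub_neg_eq_add, lineSolution, boundaryIntegral, boundaryIntegral]

lemma isRepresentedSolution_lineSolution (hu : ContinuousOn u (Icc 0 1))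
    (hj : ∀ T, 0 < T → IntervalIntegrable j volume 0 T)
    (hj' : ∀ T, 0 < T → ∃ K, ∀ s ∈ Icc 0 T, |j s| ≤ K) :
    IsRepresentedSolution u j (lineSolution u j) := by
  intro t ht
  obtain ⟨K, hK⟩ := hj' t ht
  exact ⟨continuousOn_lineSolution hu ht hK (hj t ht), fun x _ ε hε hx hx' =>
    ⟨representationConverges_of_bounded hu ht hK (hj t ht) hε hx hx',
      lineSolution_eq_representation hu ht hK (hj t ht) hε hx hx'⟩⟩

end LineSolution

section FluxBound

variable {M N : ℂ → ℂ} {u j : ℝ → ℝ} {y t K : ℝ}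

lemma integrable_two_mul_div_one_add_mul_sq (ht : 0 < t) :
    Integrable fun x : ℝ => 2 * t / (1 + t * x ^ 2) := by
  refine ((integrable_inv_one_add_sq.comp_mul_left' (Real.sqrt_ne_zero'.2 ht)).const_mul
    (2 * t)).congr (ae_of_all _ fun x => ?_)
  simp only [mul_pow, Real.sq_sqrt ht.le, div_eq_mul_inv]

lemma integral_two_mul_div_one_add_mul_sq (ht : 0 < t) :
    ∫ x : ℝ, 2 * t / (1 + t * x ^ 2) = 2 * π * √t := by
  have hsq : √t ^ 2 = t := Real.sq_sqrt ht.le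
  calc ∫ x : ℝ, 2 * t / (1 + t * x ^ 2) = ∫ x : ℝ, 2 * t * (1 + (√t * x) ^ 2)⁻¹ := by
        simp only [mul_pow, hsq, div_eq_mul_inv]
    _ = 2 * t * ((√t)⁻¹ * π) := by
        rw [integral_const_mul, Measure.integral_comp_mul_left (fun x => (1 + x ^ 2)⁻¹),
          integral_univ_inv_one_add_sq, abs_of_nonneg (by positivity), smul_eq_mul]
    _ = 2 * π * √t := by
        have := Real.sqrt_ne_zero'.2 ht
        field_simp
        rw [hsq]

lemma boundaryKernel_zero (M N : ℂ → ℂ) (y t : ℝ) (z : ℂ) :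
    boundaryKernel M N 0 y t z
      = Complex.exp (I * z * y) * (Complex.exp (-(z ^ 2 * t)) * M z) := by
  simp [boundaryKernel, duhamel, jHat]

lemma integrable_boundaryKernel_zero (hM : IsContourMultiplier M) (N : ℂ → ℂ) (ht : 0 < t)
    (hy : 0 ≤ y) : Integrable fun x : ℝ => boundaryKernel M N 0 y t (x + (1 : ℝ) * I) := by
  have hint := integrable_boundaryKernel (j := 0) hM hM ht (K := 0) (by simp)
    (by simp [Pi.zero_def]) hy one_pos
  simpa only [boundaryKernel_zero] using hint

lemma norm_duhamel_horizontalLine_le (ht : 0 ≤ t) (ht1 : t ≤ 1)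
    (hK : ∀ s ∈ Icc 0 t, |j s| ≤ K) (x : ℝ) :
    ‖duhamel j t (x + (1 : ℝ) * I)‖ ≤ Real.exp 1 * K * (2 * t / (1 + t * x ^ 2)) := by
  rw [← one_mul ‖duhamel j t _‖]
  refine mul_norm_duhamel_le ht (sq_nonneg x) (Real.exp_pos 1).le zero_le_one hK fun τ hτ => ?_
  have hre : ((x + (1 : ℝ) * I : ℂ) ^ 2).re = x ^ 2 - 1 := by
    simp [pow_two]
  rw [one_mul, hre, ← Real.exp_add, Real.exp_le_exp]
  linarith [hτ.2]

lemma norm_boundaryIntegral_sub_zero_le {C : ℝ} (hM : IsContourMultiplier M)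
    (hN : IsContourMultiplier N) (hC : ∀ z : ℂ, 1 ≤ z.im → ‖N z‖ ≤ C) (ht : 0 < t) (ht1 : t ≤ 1)
    (hK : ∀ s ∈ Icc 0 t, |j s| ≤ K) (hj : IntervalIntegrable j volume 0 t) (hy : 0 ≤ y) :
    ‖boundaryIntegral M N j y t - boundaryIntegral M N 0 y t‖
      ≤ C * (Real.exp 1 * K) * (2 * π * √t) := by
  have hpoint : ∀ x : ℝ, ‖boundaryKernel M N j y t (x + (1 : ℝ) * I)
      - boundaryKernel M N 0 y t (x + (1 : ℝ) * I)‖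
        ≤ C * (Real.exp 1 * K) * (2 * t / (1 + t * x ^ 2)) := by
    intro x
    have hNx : ‖N (x + (1 : ℝ) * I)‖ ≤ C := hC _ (by simp)
    have hexp : ‖Complex.exp (I * (x + (1 : ℝ) * I) * y)‖ ≤ 1 :=
      norm_exp_mul_ofReal_le_one (by simp) hy
    calc ‖boundaryKernel M N j y t (x + (1 : ℝ) * I)
          - boundaryKernel M N 0 y t (x + (1 : ℝ) * I)‖
        = ‖Complex.exp (I * (x + (1 : ℝ) * I) * y)‖
            * (‖N (x + (1 : ℝ) * I)‖ * ‖duhamel j t (x + (1 : ℝ) * I)‖) := by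
          rw [boundaryKernel_zero, boundaryKernel, mul_add, add_sub_cancel_left, norm_mul, norm_mul]
      _ ≤ 1 * (C * (Real.exp 1 * K * (2 * t / (1 + t * x ^ 2)))) := by
          gcongr
          · exact (norm_nonneg _).trans hNx
          · exact norm_duhamel_horizontalLine_le ht.le ht1 hK x
      _ = _ := by ring
  rw [boundaryIntegral, boundaryIntegral, ← integral_sub
    (integrable_boundaryKernel hM hN ht hK hj hy one_pos)
    (integrable_boundaryKernel_zero hM N ht hy),
    ← integral_two_mul_div_one_add_mul_sq ht, ← integral_const_mul]
  exact norm_integral_le_of_norm_le ((integrable_two_mul_div_one_add_mul_sq ht).const_mul _)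
    (ae_of_all _ hpoint)

lemma norm_one_div_two_pi_mul_le (z : ℂ) : ‖1 / (2 * (π : ℂ)) * z‖ ≤ ‖z‖ := by
  have hpi : (1 : ℝ) ≤ 2 * π := by linarith [Real.pi_gt_three]
  rw [norm_mul, norm_div, norm_one, norm_mul, Complex.norm_ofNat, Complex.norm_real,
    Real.norm_of_nonneg Real.pi_pos.le]
  exact mul_le_of_le_one_left (norm_nonneg z) ((div_le_one₀ (by positivity)).2 hpi)

lemma exists_norm_lineSolution_sub_zero_le (hu : ContinuousOn u (Icc 0 1))
    (hK : ∀ s ∈ Icc 0 1, |j s| ≤ K) (hj : IntervalIntegrable j volume 0 1) :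
    ∃ C : ℝ, ∀ t ∈ Ioc (0 : ℝ) 1, ∀ x ∈ Icc (0 : ℝ) 1,
      ‖lineSolution u j x t - lineSolution u 0 x t‖ ≤ C * √t := by
  obtain ⟨A, hA⟩ := isContourMultiplier_fluxPlus.exists_norm_le 1 one_pos
  obtain ⟨B, hB⟩ := isContourMultiplier_fluxMinus.exists_norm_le 1 one_pos
  refine ⟨(A + B) * (Real.exp 1 * K) * (2 * π), fun t ht x hx => ?_⟩
  have hKt : ∀ s ∈ Icc 0 t, |j s| ≤ K := fun s hs => hK s ⟨hs.1, hs.2.trans ht.2⟩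
  have hjt : IntervalIntegrable j volume 0 t :=
    hj.mono_set (by rw [uIcc_of_le ht.1.le, uIcc_of_le zero_le_one]; gcongr; exact ht.2)
  have hplus := norm_boundaryIntegral_sub_zero_le (isContourMultiplier_coefPlus hu)
    isContourMultiplier_fluxPlus hA ht.1 ht.2 hKt hjt hx.1
  have hminus := norm_boundaryIntegral_sub_zero_le (isContourMultiplier_coefMinus hu)
    isContourMultiplier_fluxMinus hB ht.1 ht.2 hKt hjt (sub_nonneg.2 hx.2)
  rw [lineSolution, lineSolution, ← mul_sub]
  refine (norm_one_div_two_pi_mul_le _).trans ?_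
  rw [add_sub_add_comm, sub_sub_sub_cancel_left]
  refine (norm_add_le _ _).trans ?_
  rw [norm_sub_rev]
  linarith

end FluxBound

section Linearity

variable {u v : ℝ → ℝ}

lemma coefPlus_add_smul (hu : ContinuousOn u (Icc 0 1)) (hv : ContinuousOn v (Icc 0 1)) (c : ℝ)
    (z : ℂ) : coefPlus (u + c • v) z = coefPlus u z + c * coefPlus v z := by
  have hreflect : (fun x => (u + c • v) (1 - x)) = (fun x => u (1 - x)) + c • fun x => v (1 - x) :=
    rfl
  rw [coefPlus, coefPlus, coefPlus, hreflect, uHat_add_smul hu hv,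
    uHat_add_smul (continuousOn_comp_one_sub hu) (continuousOn_comp_one_sub hv)]
  ring

lemma coefMinus_add_smul (hu : ContinuousOn u (Icc 0 1)) (hv : ContinuousOn v (Icc 0 1)) (c : ℝ)
    (z : ℂ) : coefMinus (u + c • v) z = coefMinus u z + c * coefMinus v z := by
  have hreflect : (fun x => (u + c • v) (1 - x)) = (fun x => u (1 - x)) + c • fun x => v (1 - x) :=
    rfl
  rw [coefMinus, coefMinus, coefMinus, hreflect, uHat_add_smul hu hv,
    uHat_add_smul (continuousOn_comp_one_sub hu) (continuousOn_comp_one_sub hv)]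
  ring

lemma boundaryIntegral_zero_add_smul {L M P : ℂ → ℂ} (hL : IsContourMultiplier L)
    (hM : IsContourMultiplier M) {c : ℂ} (hP : ∀ z, P z = L z + c * M z) (N : ℂ → ℂ) {y t : ℝ}
    (ht : 0 < t) (hy : 0 ≤ y) :
    boundaryIntegral P N 0 y t = boundaryIntegral L N 0 y t + c * boundaryIntegral M N 0 y t := by
  rw [boundaryIntegral, boundaryIntegral, boundaryIntegral, ← integral_const_mul,
    ← integral_add (integrable_boundaryKernel_zero hL N ht hy)
      ((integrable_boundaryKernel_zero hM N ht hy).const_mul c)]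
  refine integral_congr_ae (ae_of_all _ fun x => ?_)
  simp only [boundaryKernel_zero, hP]
  ring

lemma lineSolution_zero_add_smul (hu : ContinuousOn u (Icc 0 1)) (hv : ContinuousOn v (Icc 0 1))
    (c : ℝ) {x t : ℝ} (ht : 0 < t) (hx : x ∈ Icc (0 : ℝ) 1) :
    lineSolution (u + c • v) 0 x t = lineSolution u 0 x t + c * lineSolution v 0 x t := by
  have hreal : ∫ l : ℝ, integrandReal (u + c • v) x t l
      = (∫ l : ℝ, integrandReal u x t l) + c * ∫ l : ℝ, integrandReal v x t l := by
    rw [← integral_const_mul, ← integral_add (integrable_integrandReal hu x ht)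
      ((integrable_integrandReal hv x ht).const_mul _)]
    refine integral_congr_ae (ae_of_all _ fun l => ?_)
    simp only [integrandReal, uHat_add_smul hu hv]
    ring
  rw [lineSolution, lineSolution, lineSolution, hreal,
    boundaryIntegral_zero_add_smul (isContourMultiplier_coefPlus hu)
      (isContourMultiplier_coefPlus hv) (coefPlus_add_smul hu hv c) fluxPlus ht hx.1,
    boundaryIntegral_zero_add_smul (isContourMultiplier_coefMinus hu)
      (isContourMultiplier_coefMinus hv) (coefMinus_add_smul hu hv c) fluxMinus ht
      (sub_nonneg.2 hx.2)]
  ring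

end Linearity

section HeatDefect

variable {t C v : ℝ}

/-- Bound for the error made by replacing the factor `e^{-z²t}` by `1` in the integral, over the
line `Im z = v`, of a function of size `C / (1 + (Re z)²)`. -/
def heatDefect (v C t : ℝ) : ℝ :=
  ∫ x : ℝ, ‖Complex.exp (-((x + v * I) ^ 2 * t)) - 1‖ * (C / (1 + x ^ 2))

lemma norm_exp_neg_sq_mul_sub_one_le (ht : t ∈ Icc (0 : ℝ) 1) (v x : ℝ) :
    ‖Complex.exp (-((x + v * I) ^ 2 * t)) - 1‖ ≤ Real.exp (v ^ 2) + 1 := by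
  have hre : (-((x + v * I : ℂ) ^ 2 * t)).re = (v ^ 2 - x ^ 2) * t := by
    have hsq : ((x + v * I : ℂ) ^ 2).re = x ^ 2 - v ^ 2 := by
      simp [pow_two]
    rw [Complex.neg_re, Complex.re_mul_ofReal, hsq]
    ring
  refine (norm_sub_le _ _).trans (add_le_add ?_ norm_one.le)
  rw [Complex.norm_exp, hre, Real.exp_le_exp]
  nlinarith [ht.1, ht.2, sq_nonneg v, mul_nonneg ht.1 (sq_nonneg x)]

lemma norm_heatDefect_integrand_le (ht : t ∈ Icc (0 : ℝ) 1) (v C x : ℝ) :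
    ‖‖Complex.exp (-((x + v * I) ^ 2 * t)) - 1‖ * (C / (1 + x ^ 2))‖
      ≤ (Real.exp (v ^ 2) + 1) * (|C| / (1 + x ^ 2)) := by
  have hpos : 0 ≤ 1 + x ^ 2 := by positivity
  rw [norm_mul, norm_norm, norm_div, Real.norm_eq_abs, Real.norm_of_nonneg hpos]
  gcongr
  exact norm_exp_neg_sq_mul_sub_one_le ht v x

lemma continuous_heatDefect_integrand (v C t : ℝ) : Continuous fun x : ℝ =>
    ‖Complex.exp (-((x + v * I) ^ 2 * t)) - 1‖ * (C / (1 + x ^ 2)) :=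
  Continuous.mul (by fun_prop)
    (Continuous.div (by fun_prop) (by fun_prop) fun x => by positivity)

lemma integrable_heatDefect_integrand (ht : t ∈ Icc (0 : ℝ) 1) (v C : ℝ) : Integrable fun x : ℝ =>
    ‖Complex.exp (-((x + v * I) ^ 2 * t)) - 1‖ * (C / (1 + x ^ 2)) :=
  ((integrable_const_div_one_add_sq |C|).const_mul _).mono'
    (continuous_heatDefect_integrand v C t).aestronglyMeasurable
    (ae_of_all _ (norm_heatDefect_integrand_le ht v C))

lemma tendsto_heatDefect (v C : ℝ) : Tendsto (heatDefect v C) (𝓝[>] 0) (𝓝 0) := by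
  suffices Tendsto (heatDefect v C) (𝓝[>] 0) (𝓝 (∫ _ : ℝ, (0 : ℝ))) by
    simpa only [integral_zero] using this
  refine tendsto_integral_filter_of_dominated_convergence _
    (Eventually.of_forall fun t => (continuous_heatDefect_integrand v C t).aestronglyMeasurable)
    ?_ ((integrable_const_div_one_add_sq |C|).const_mul (Real.exp (v ^ 2) + 1))
    (ae_of_all _ fun x => ?_)
  · filter_upwards [Ioc_mem_nhdsGT one_pos] with t ht
    exact ae_of_all _ (norm_heatDefect_integrand_le ⟨ht.1.le, ht.2⟩ v C)
  · have hcont : Continuous fun t : ℝ =>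
        ‖Complex.exp (-((x + v * I) ^ 2 * t)) - 1‖ * (C / (1 + x ^ 2)) := by fun_prop
    simpa using (hcont.tendsto 0).mono_left nhdsWithin_le_nhds

lemma norm_integral_exp_mul_sub_integral_le {f : ℝ → ℂ} (ht : t ∈ Icc (0 : ℝ) 1)
    (hf : Integrable f) (hexpf : Integrable fun x : ℝ => Complex.exp (-((x + v * I) ^ 2 * t)) * f x)
    (hC : ∀ x, ‖f x‖ ≤ C / (1 + x ^ 2)) :
    ‖(∫ x : ℝ, Complex.exp (-((x + v * I) ^ 2 * t)) * f x) - ∫ x : ℝ, f x‖ ≤ heatDefect v C t := by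
  rw [← integral_sub hexpf hf]
  refine norm_integral_le_of_norm_le (integrable_heatDefect_integrand ht v C)
    (ae_of_all _ fun x => ?_)
  rw [← sub_one_mul, norm_mul]
  gcongr
  exact hC x

end HeatDefect

section VanishingEndpoints

variable {w : ℝ → ℝ} {x y t C : ℝ}

lemma integral_horizontalLine_eq_zero {E : Type*} [NormedAddCommGroup E] [NormedSpace ℂ E]
    {f : ℂ → E} {a : ℝ} (hd : ∀ z : ℂ, a ≤ z.im → DifferentiableAt ℂ f z)
    (hf : ∀ z : ℂ, a ≤ z.im → ‖f z‖ ≤ C / (1 + ‖z‖ ^ 2)) : ∫ x : ℝ, f (x + a * I) = 0 := by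
  have hC : 0 ≤ C := by
    have := (norm_nonneg _).trans (hf (a * I) (by simp))
    rwa [le_div_iff₀ (by positivity), zero_mul] at this
  have hnorm : ∀ x v : ℝ, ‖(x + v * I : ℂ)‖ ^ 2 = x ^ 2 + v ^ 2 := fun x v => by
    rw [Complex.sq_norm, Complex.normSq_add_mul_I]
  have hre : ∀ v : ℝ, a ≤ v → ∀ x : ℝ, ‖f (x + v * I)‖ ≤ C / (1 + x ^ 2) := fun v hv x =>
    (hf _ (by simpa using hv)).trans (by rw [hnorm]; gcongr; linarith [sq_nonneg v])
  have him : ∀ v : ℝ, a ≤ v → ∀ x : ℝ, ‖f (x + v * I)‖ ≤ C / (1 + v ^ 2) := fun v hv x =>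
    (hf _ (by simpa using hv)).trans (by rw [hnorm]; gcongr; linarith [sq_nonneg x])
  have hlim : Tendsto (fun v : ℝ => ∫ x : ℝ, f (x + v * I)) atTop (𝓝 (∫ _ : ℝ, (0 : E))) := by
    refine tendsto_integral_filter_of_dominated_convergence _ ?_ ?_
      (integrable_const_div_one_add_sq C) (ae_of_all _ fun x => ?_)
    · filter_upwards [eventually_ge_atTop a] with v hv
      exact (integrable_horizontalLine (fun z hz => (hd z (hz ▸ hv)).continuousAt)
        (hre v hv)).aestronglyMeasurable
    · filter_upwards [eventually_ge_atTop a] with v hv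
      exact ae_of_all _ (hre v hv)
    · refine squeeze_zero_norm' ?_ (tendsto_const_div_one_add_sq_atTop C)
      filter_upwards [eventually_ge_atTop a] with v hv using him v hv x
  rw [integral_zero] at hlim
  refine tendsto_nhds_unique (tendsto_const_nhds.congr' ?_) hlim
  filter_upwards [eventually_ge_atTop a] with v hv
  exact integral_horizontalLine_eq hv (fun z hz => hd z hz.1) fun x y hy => hre y hy.1 x

lemma exists_norm_uHat_le_div_one_add_sq (hw : ContDiffOn ℝ 2 w (Icc 0 1)) (h0 : w 0 = 0)
    (h1 : w 1 = 0) : ∃ K : ℝ, ∀ z : ℂ, z.re ≤ 0 → ‖uHat w z‖ ≤ K / (1 + ‖z‖ ^ 2) := by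
  obtain ⟨A, hA⟩ := exists_norm_uHat_le hw.continuousOn
  obtain ⟨B, hB⟩ := exists_sq_mul_norm_uHat_le hw h0 h1
  refine ⟨A + B, fun z hz => ?_⟩
  rw [le_div_iff₀ (by positivity)]
  linarith [hA z hz, hB z hz]

lemma exists_norm_coef_le_div_one_add_sq (hw : ContDiffOn ℝ 2 w (Icc 0 1)) (h0 : w 0 = 0)
    (h1 : w 1 = 0) : ∃ C : ℝ, ∀ z : ℂ, 1 ≤ z.im →
      ‖coefPlus w z‖ ≤ C / (1 + ‖z‖ ^ 2) ∧ ‖coefMinus w z‖ ≤ C / (1 + ‖z‖ ^ 2) := by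
  have hreflect : ContDiffOn ℝ 2 (fun x => w (1 - x)) (Icc 0 1) :=
    hw.comp (contDiff_const.sub contDiff_id).contDiffOn
      fun x hx => ⟨sub_nonneg.2 hx.2, sub_le_self _ hx.1⟩
  obtain ⟨c, hc⟩ := exists_one_add_norm_mul_exp_le_mul_norm_Delta one_pos
  obtain ⟨A, hA⟩ := exists_norm_uHat_le_div_one_add_sq hw h0 h1
  obtain ⟨B, hB⟩ := exists_norm_uHat_le_div_one_add_sq hreflect (by simpa using h1)
    (by simpa using h0)
  refine ⟨c * (2 * max A B), fun z hz => ?_⟩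
  have hre : (I * z).re ≤ 0 := by
    simp only [Complex.I_mul_re]
    linarith
  have hnorm : ‖I * z‖ = ‖z‖ := by
    rw [norm_mul, Complex.norm_I, one_mul]
  have hu : ‖uHat w (I * z)‖ ≤ max A B / (1 + ‖z‖ ^ 2) :=
    hnorm ▸ (hA _ hre).trans (by gcongr; exact le_max_left _ _)
  have hu' : ‖uHat (fun x => w (1 - x)) (I * z)‖ ≤ max A B / (1 + ‖z‖ ^ 2) :=
    hnorm ▸ (hB _ hre).trans (by gcongr; exact le_max_right _ _)
  have hz0 : 0 < z.im := one_pos.trans_le hz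
  simp only [mul_div_assoc]
  exact ⟨norm_coefPlus_le (hc z hz) hz0 hu hu', norm_coefMinus_le (hc z hz) hz0 hu hu'⟩

lemma norm_boundaryIntegral_zero_le {M : ℂ → ℂ} (hM : IsContourMultiplier M)
    (hC : ∀ z : ℂ, 1 ≤ z.im → ‖M z‖ ≤ C / (1 + ‖z‖ ^ 2)) (N : ℂ → ℂ) (ht : t ∈ Ioc (0 : ℝ) 1)
    (hy : 0 ≤ y) : ‖boundaryIntegral M N 0 y t‖ ≤ heatDefect 1 C t := by
  set f : ℂ → ℂ := fun z => Complex.exp (I * z * y) * M z with hf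
  have hd : ∀ z : ℂ, 1 ≤ z.im → DifferentiableAt ℂ f z := fun z hz =>
    DifferentiableAt.mul (by fun_prop) (hM.differentiableAt z (one_pos.trans_le hz))
  have hle : ∀ z : ℂ, 1 ≤ z.im → ‖f z‖ ≤ C / (1 + ‖z‖ ^ 2) := by
    intro z hz
    refine (norm_mul _ _).trans_le ((mul_le_of_le_one_left (norm_nonneg _) ?_).trans (hC z hz))
    exact norm_exp_mul_ofReal_le_one (by simp only [Complex.I_mul_re]; linarith) hy
  have hC0 : 0 ≤ C := by
    have := (norm_nonneg _).trans (hle I (by simp))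
    rwa [le_div_iff₀ (by positivity), zero_mul] at this
  have hline : ∀ x : ℝ, ‖f (x + (1 : ℝ) * I)‖ ≤ C / (1 + x ^ 2) := fun x =>
    (hle _ (by simp)).trans (by rw [Complex.sq_norm, Complex.normSq_add_mul_I]; gcongr; simp)
  have hfactor : ∀ x : ℝ, boundaryKernel M N 0 y t (x + (1 : ℝ) * I)
      = Complex.exp (-((x + (1 : ℝ) * I) ^ 2 * t)) * f (x + (1 : ℝ) * I) := fun x => by
    rw [boundaryKernel_zero, hf, mul_left_comm]
  have hkernel := integrable_boundaryKernel_zero hM N ht.1 hy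
  simp only [hfactor] at hkernel
  have hdefect := norm_integral_exp_mul_sub_integral_le ⟨ht.1.le, ht.2⟩
    (integrable_horizontalLine (fun z hz => (hd z hz.ge).continuousAt) hline) hkernel hline
  rw [integral_horizontalLine_eq_zero hd hle, sub_zero] at hdefect
  simpa only [boundaryIntegral, hfactor] using hdefect

open FourierTransform in
lemma fourier_indicator_Icc_eq_uHat (f : ℝ → ℝ) (ξ : ℝ) :
    𝓕 ((Icc (0 : ℝ) 1).indicator fun y => (f y : ℂ)) ξ
      = uHat f (-(I * (2 * π * ξ : ℝ))) := by
  rw [Real.fourier_real_eq_integral_exp_smul, uHat, intervalIntegral.integral_of_le zero_le_one,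
    ← integral_Icc_eq_integral_Ioc, ← integral_indicator measurableSet_Icc]
  refine integral_congr_ae (ae_of_all _ fun y => ?_)
  by_cases hy : y ∈ Icc (0 : ℝ) 1
  · simp only [indicator_of_mem hy, smul_eq_mul]
    congr 2
    push_cast
    ring
  · simp only [indicator_of_notMem hy, smul_zero]

open FourierTransform in
lemma integral_integrandReal_zero (hw : ContinuousOn w (Icc 0 1)) (h0 : w 0 = 0) (h1 : w 1 = 0)
    (hint : Integrable fun l : ℝ => uHat w (-(I * l))) (hx : x ∈ Icc (0 : ℝ) 1) :
    ∫ l : ℝ, integrandReal w x 0 l = 2 * π * w x := by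
  set W : ℝ → ℂ := (Icc (0 : ℝ) 1).indicator fun y => (w y : ℂ)
  have hWx : W x = w x := indicator_of_mem hx _
  have hw' : ContinuousOn (fun y => (w y : ℂ)) (Icc 0 1) :=
    Complex.continuous_ofReal.comp_continuousOn hw
  have hWcont : Continuous W := by
    refine continuous_indicator (fun a ha => ?_) (by rwa [isClosed_Icc.closure_eq])
    rw [frontier_Icc zero_le_one] at ha
    rcases ha with rfl | rfl <;> simp [h0, h1]
  have hWint : Integrable W := (integrable_indicator_iff measurableSet_Icc).2 hw'.integrableOn_Icc
  have hFint : Integrable (𝓕 W) :=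
    (hint.comp_mul_left' Real.two_pi_pos.ne').congr
      (ae_of_all _ fun ξ => (fourier_indicator_Icc_eq_uHat w ξ).symm)
  have hinversion : ∫ ξ : ℝ, integrandReal w x 0 ((2 * π * ξ : ℝ) : ℂ) = w x := by
    rw [← hWx, ← congrFun (hWcont.fourierInv_fourier_eq hWint hFint) x, Real.fourierInv_eq']
    refine integral_congr_ae (ae_of_all _ fun ξ => ?_)
    simp only [W, fourier_indicator_Icc_eq_uHat, integrandReal, elem, smul_eq_mul]
    congr 2
    simp only [Complex.ofReal_mul, Complex.ofReal_ofNat, Complex.ofReal_zero, mul_zero, sub_zero,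
      RCLike.inner_apply, Real.ringHom_apply]
    ring
  have hscale := Measure.integral_comp_mul_left (fun l : ℝ => integrandReal w x 0 l) (2 * π)
  rw [hinversion, abs_of_pos (by positivity), Complex.real_smul] at hscale
  have hpi : (π : ℂ) ≠ 0 := by exact_mod_cast Real.pi_ne_zero
  rw [hscale]
  push_cast
  field_simp

lemma norm_integral_integrandReal_sub_le (hw : ContinuousOn w (Icc 0 1)) (h0 : w 0 = 0)
    (h1 : w 1 = 0) (hC : ∀ z : ℂ, z.re ≤ 0 → ‖uHat w z‖ ≤ C / (1 + ‖z‖ ^ 2))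
    (ht : t ∈ Ioc (0 : ℝ) 1) (hx : x ∈ Icc (0 : ℝ) 1) :
    ‖(∫ l : ℝ, integrandReal w x t l) - 2 * π * w x‖ ≤ heatDefect 0 C t := by
  have hle : ∀ l : ℝ, ‖uHat w (-(I * l))‖ ≤ C / (1 + l ^ 2) := fun l => by
    simpa using hC (-(I * l)) (by simp)
  have hcont := (differentiable_uHat hw).continuous
  have hint : Integrable fun l : ℝ => uHat w (-(I * l)) :=
    (integrable_const_div_one_add_sq C).mono' (Continuous.aestronglyMeasurable (by fun_prop))
      (ae_of_all _ hle)
  have hle0 : ∀ l : ℝ, ‖integrandReal w x 0 l‖ ≤ C / (1 + l ^ 2) := fun l => by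
    simpa [integrandReal, elem, Complex.norm_exp] using hle l
  have hint0 : Integrable fun l : ℝ => integrandReal w x 0 l := by
    refine (integrable_const_div_one_add_sq C).mono' (Continuous.aestronglyMeasurable ?_)
      (ae_of_all _ hle0)
    unfold integrandReal elem
    fun_prop
  have hfactor : ∀ l : ℝ, integrandReal w x t l
      = Complex.exp (-((l + (0 : ℝ) * I) ^ 2 * t)) * integrandReal w x 0 l := fun l => by
    simp only [integrandReal, elem_eq_exp_mul_exp]
    simp only [Complex.ofReal_zero, zero_mul, add_zero, mul_zero, neg_zero, Complex.exp_zero,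
      mul_one]
    ring
  have hintt := integrable_integrandReal hw x ht.1
  simp only [hfactor] at hintt ⊢
  rw [← integral_integrandReal_zero hw h0 h1 hint hx]
  exact norm_integral_exp_mul_sub_integral_le ⟨ht.1.le, ht.2⟩ hint0 hintt hle0

lemma exists_norm_lineSolution_zero_sub_le (hw : ContDiffOn ℝ 2 w (Icc 0 1)) (h0 : w 0 = 0)
    (h1 : w 1 = 0) : ∃ A B : ℝ, ∀ t ∈ Ioc (0 : ℝ) 1, ∀ x ∈ Icc (0 : ℝ) 1,
      ‖lineSolution w 0 x t - w x‖ ≤ heatDefect 0 A t + 2 * heatDefect 1 B t := by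
  obtain ⟨A, hA⟩ := exists_norm_uHat_le_div_one_add_sq hw h0 h1
  obtain ⟨B, hB⟩ := exists_norm_coef_le_div_one_add_sq hw h0 h1
  refine ⟨A, B, fun t ht x hx => ?_⟩
  have hreal := norm_integral_integrandReal_sub_le hw.continuousOn h0 h1 hA ht hx
  have hplus := norm_boundaryIntegral_zero_le (isContourMultiplier_coefPlus hw.continuousOn)
    (fun z hz => (hB z hz).1) fluxPlus ht hx.1
  have hminus := norm_boundaryIntegral_zero_le (isContourMultiplier_coefMinus hw.continuousOn)
    (fun z hz => (hB z hz).2) fluxMinus ht (sub_nonneg.2 hx.2)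
  have hsplit : lineSolution w 0 x t - w x = 1 / (2 * (π : ℂ)) *
      (((∫ l : ℝ, integrandReal w x t l) - 2 * π * w x)
        - boundaryIntegral (coefPlus w) fluxPlus 0 x t
        + boundaryIntegral (coefMinus w) fluxMinus 0 (1 - x) t) := by
    have hpi : (π : ℂ) ≠ 0 := by exact_mod_cast Real.pi_ne_zero
    rw [lineSolution]
    field_simp
    ring
  rw [hsplit]
  refine (norm_one_div_two_pi_mul_le _).trans ((norm_add_le _ _).trans ?_)
  linarith [norm_sub_le ((∫ l : ℝ, integrandReal w x t l) - 2 * π * w x)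
    (boundaryIntegral (coefPlus w) fluxPlus 0 x t)]

end VanishingEndpoints

section OddPole

lemma integral_eq_zero_of_odd {E : Type*} [NormedAddCommGroup E] [NormedSpace ℝ E] {f : ℝ → E}
    (hf : ∀ x, x ≠ 0 → f (-x) = -f x) : ∫ x, f x = 0 := by
  have hneg : ∫ x, f x = -∫ x, f x := by
    rw [← integral_neg_eq_self f volume, ← integral_neg, integral_neg_eq_self f volume]
    refine integral_congr_ae ?_
    filter_upwards [Measure.ae_ne volume 0] with x hx
    rw [← hf (-x) (neg_ne_zero.2 hx), neg_neg]
  have htwo : (2 : ℝ) • ∫ x, f x = 0 := by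
    rw [two_smul]
    exact add_eq_zero_iff_eq_neg.2 hneg
  exact (smul_eq_zero.1 htwo).resolve_left two_ne_zero

lemma exists_norm_le_div_one_add_sq_of_sq_mul {E : Type*} [NormedAddCommGroup E]
    {f : ℂ → E} {a b B : ℝ} (hf : ContinuousOn f {z | z.im ∈ Icc a b})
    (hB : ∀ z : ℂ, z.im ∈ Icc a b → ‖z‖ ^ 2 * ‖f z‖ ≤ B) :
    ∃ C : ℝ, ∀ x y : ℝ, y ∈ Icc a b → ‖f (x + y * I)‖ ≤ C / (1 + x ^ 2) := by
  obtain ⟨K, hK⟩ := (isCompact_Icc (a := (-1 : ℝ)) (b := 1)).reProdIm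
    (isCompact_Icc (a := a) (b := b)) |>.exists_bound_of_continuousOn (hf.mono fun z hz => hz.2)
  refine ⟨2 * max K B, fun x y hy => ?_⟩
  rw [le_div_iff₀ (by positivity)]
  rcases le_or_gt |x| 1 with hx | hx
  · have hle := hK (x + y * I) (by simpa [Complex.mem_reProdIm] using ⟨abs_le.1 hx, hy⟩)
    nlinarith [norm_nonneg (f (x + y * I)), (sq_le_one_iff_abs_le_one x).2 hx, le_max_left K B]
  · have hle := hB (x + y * I) (by simpa using hy)
    rw [Complex.sq_norm, Complex.normSq_add_mul_I] at hle
    nlinarith [mul_nonneg (sq_nonneg y) (norm_nonneg (f (x + y * I))), norm_nonneg (f (x + y * I)),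
      (one_lt_sq_iff_one_lt_abs x).2 hx, le_max_right K B]

lemma norm_le_norm_four_add_sq {z : ℂ} (hz : z.im ∈ Icc (0 : ℝ) 1) : ‖z‖ ≤ ‖4 + z ^ 2‖ := by
  have hfactor : 4 + z ^ 2 = (z + 2 * I) * (z - 2 * I) := by
    linear_combination (4 : ℂ) * Complex.I_sq
  have hupper : ‖z‖ ≤ ‖z + 2 * I‖ := by
    rw [Complex.norm_def, Complex.norm_def]
    refine Real.sqrt_le_sqrt ?_
    simp only [Complex.normSq_apply, Complex.add_re, Complex.add_im, Complex.mul_re,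
      Complex.mul_im, Complex.re_ofNat, Complex.im_ofNat, Complex.I_re, Complex.I_im]
    nlinarith [hz.1]
  have hlower : 1 ≤ ‖z - 2 * I‖ := by
    refine le_trans ?_ (Complex.abs_im_le_norm _)
    simp only [Complex.sub_im, Complex.mul_im, Complex.re_ofNat, Complex.im_ofNat, Complex.I_re,
      Complex.I_im]
    rw [le_abs]
    right
    linarith [hz.2]
  rw [hfactor, norm_mul]
  exact hupper.trans (le_mul_of_one_le_right (norm_nonneg _) hlower)

lemma norm_four_mul_div_four_add_sq_le {z : ℂ} (hz : z.im ∈ Icc (0 : ℝ) 1) :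
    ‖4 * z / (4 + z ^ 2)‖ ≤ 4 := by
  rw [norm_div, norm_mul, Complex.norm_ofNat]
  exact div_le_of_le_mul₀ (norm_nonneg _) (by norm_num)
    (mul_le_mul_of_nonneg_left (norm_le_norm_four_add_sq hz) (by norm_num))

lemma four_add_sq_ne_zero {z : ℂ} (hz : |z.im| < 2) : 4 + z ^ 2 ≠ 0 := by
  intro h
  have hfactor : (z - 2 * I) * (z + 2 * I) = 0 := by
    linear_combination h - (4 : ℂ) * Complex.I_sq
  rcases mul_eq_zero.1 hfactor with h | h
  · simp [sub_eq_zero.1 h] at hz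
  · simp [eq_neg_of_add_eq_zero_left h] at hz

lemma integral_one_div_nine_add_sq : ∫ x : ℝ, 1 / (9 + x ^ 2) = π / 3 := by
  have hscale := Measure.integral_comp_div (fun x : ℝ => (1 + x ^ 2)⁻¹) 3
  rw [integral_univ_inv_one_add_sq, abs_of_pos three_pos, smul_eq_mul] at hscale
  have hpoint : ∀ x : ℝ, 1 / (9 + x ^ 2) = 1 / 9 * (1 + (x / 3) ^ 2)⁻¹ := fun x => by
    field_simp
    ring
  simp only [hpoint]
  rw [integral_const_mul, hscale]
  ring

lemma four_div_mul_four_add_sq_eq (x : ℝ) :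
    4 / ((x + (1 : ℝ) * I) * (4 + (x + (1 : ℝ) * I) ^ 2))
      = ((4 * x / ((1 + x ^ 2) * (9 + x ^ 2)) : ℝ) : ℂ)
        + I * ((3 / 2 * (1 / (9 + x ^ 2) - (1 + x ^ 2)⁻¹) : ℝ) : ℂ) := by
  have hz : (x + (1 : ℝ) * I : ℂ) ≠ 0 := fun h => by simpa using congrArg Complex.im h
  have hz' : 4 + (x + (1 : ℝ) * I : ℂ) ^ 2 ≠ 0 := four_add_sq_ne_zero (by simp)
  have hnine : (9 + (x : ℂ) ^ 2) ≠ 0 := by exact_mod_cast (by positivity : 9 + x ^ 2 ≠ 0)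
  have hone : (1 + (x : ℂ) ^ 2) ≠ 0 := by exact_mod_cast (by positivity : 1 + x ^ 2 ≠ 0)
  have hconj : (x + (1 : ℝ) * I) * (4 + (x + (1 : ℝ) * I) ^ 2) * (x - 3 * I)
      = (1 + (x : ℂ) ^ 2) * (9 + (x : ℂ) ^ 2) := by
    push_cast
    linear_combination (-9 - 6 * (x : ℂ) ^ 2 - 8 * x * I - 3 * I ^ 2) * Complex.I_sq
  have hcombine : ((4 * x / ((1 + x ^ 2) * (9 + x ^ 2)) : ℝ) : ℂ)
      + I * ((3 / 2 * (1 / (9 + x ^ 2) - (1 + x ^ 2)⁻¹) : ℝ) : ℂ)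
      = 4 * (x - 3 * I) / ((1 + (x : ℂ) ^ 2) * (9 + (x : ℂ) ^ 2)) := by
    push_cast
    field_simp
    ring
  rw [hcombine, div_eq_div_iff (mul_ne_zero hz hz') (mul_ne_zero hone hnine), ← hconj]
  ring

lemma integral_ofReal_add_I_mul_ofReal {α : Type*} [MeasurableSpace α] {μ : Measure α} {f g : α → ℝ}
    (hf : Integrable f μ) (hg : Integrable g μ) :
    ∫ a, ((f a : ℂ) + I * (g a : ℂ)) ∂μ = (∫ a, f a ∂μ : ℝ) + I * (∫ a, g a ∂μ : ℝ) := by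
  rw [← integral_complex_ofReal, ← integral_complex_ofReal, ← integral_const_mul]
  exact integral_add hf.ofReal (hg.ofReal.const_mul I)

lemma integral_four_div_mul_four_add_sq :
    ∫ x : ℝ, 4 / ((x + (1 : ℝ) * I) * (4 + (x + (1 : ℝ) * I) ^ 2)) = -(I * π) := by
  have hnine : Integrable fun x : ℝ => 1 / (9 + x ^ 2) := by
    refine Integrable.of_integral_ne_zero ?_
    rw [integral_one_div_nine_add_sq]
    positivity
  have hodd : Integrable fun x : ℝ => 4 * x / ((1 + x ^ 2) * (9 + x ^ 2)) := by
    refine (integrable_const_div_one_add_sq 4).mono' ?_ (ae_of_all _ fun x => ?_)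
    · exact (Continuous.div (by fun_prop) (by fun_prop) fun x =>
        by positivity).aestronglyMeasurable
    · rw [norm_div, norm_mul, Real.norm_of_nonneg (by positivity : 0 ≤ (1 + x ^ 2) * (9 + x ^ 2)),
        div_le_div_iff₀ (by positivity) (by positivity), Real.norm_ofNat, Real.norm_eq_abs]
      have : |x| ≤ 9 + x ^ 2 := by nlinarith [sq_abs x, sq_nonneg (|x| - 1)]
      nlinarith [sq_nonneg x]
  have himag : Integrable fun x : ℝ => 3 / 2 * (1 / (9 + x ^ 2) - (1 + x ^ 2)⁻¹) :=
    (hnine.sub integrable_inv_one_add_sq).const_mul _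
  simp only [four_div_mul_four_add_sq_eq]
  refine (integral_ofReal_add_I_mul_ofReal hodd himag).trans ?_
  rw [integral_eq_zero_of_odd (f := fun x => 4 * x / ((1 + x ^ 2) * (9 + x ^ 2)))
      (fun x _ => by ring), integral_const_mul, integral_sub hnine integrable_inv_one_add_sq,
    integral_one_div_nine_add_sq, integral_univ_inv_one_add_sq]
  push_cast
  ring

lemma exists_differentiableOn_eq_inv_sq_smul {E : Type*} [NormedAddCommGroup E] [NormedSpace ℂ E]
    [CompleteSpace E] {f : ℂ → E} {s : Set ℂ} {c : ℂ} (hs : s ∈ 𝓝 c) (hf : DifferentiableOn ℂ f s)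
    (hc : f c = 0) (hc' : deriv f c = 0) :
    ∃ g : ℂ → E, DifferentiableOn ℂ g s ∧ ∀ z, z ≠ c → g z = ((z - c) ^ 2)⁻¹ • f z := by
  refine ⟨dslope (dslope f c) c, ?_, fun z hz => ?_⟩
  · rwa [Complex.differentiableOn_dslope hs, Complex.differentiableOn_dslope hs]
  · rw [dslope_of_ne _ hz, slope_def_module, dslope_of_ne _ hz, slope_def_module, dslope_same, hc,
      hc', sub_zero, sub_zero, smul_smul, ← mul_inv, ← pow_two]

lemma integral_horizontalLine_div_sq_eq_zero_of_odd {k : ℂ → ℂ} {s : Set ℂ} {B : ℝ}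
    (hs : IsOpen s) (hstrip : {z | z.im ∈ Icc (0 : ℝ) 1} ⊆ s) (hd : DifferentiableOn ℂ k s)
    (hk' : deriv k 0 = 0) (hodd : ∀ z, k (-z) = -k z)
    (hB : ∀ z : ℂ, z.im ∈ Icc (0 : ℝ) 1 → ‖k z‖ ≤ B) :
    (Integrable fun x : ℝ => k (x + (1 : ℝ) * I) / (x + (1 : ℝ) * I) ^ 2) ∧
      ∫ x : ℝ, k (x + (1 : ℝ) * I) / (x + (1 : ℝ) * I) ^ 2 = 0 := by
  have hk0 : k 0 = 0 := by
    have := hodd 0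
    rwa [neg_zero, self_eq_neg] at this
  obtain ⟨g, hgd, hgk⟩ := exists_differentiableOn_eq_inv_sq_smul
    (hs.mem_nhds (hstrip (by simp))) hd hk0 hk'
  simp only [sub_zero, smul_eq_mul] at hgk
  have hB0 : 0 ≤ B := (norm_nonneg _).trans (hB 0 (by simp))
  obtain ⟨C, hC⟩ := exists_norm_le_div_one_add_sq_of_sq_mul (hgd.continuousOn.mono hstrip)
    (B := B) fun z hz => by
      rcases eq_or_ne z 0 with rfl | hz0
      · simpa using hB0
      · rw [← norm_pow, ← norm_mul, hgk z hz0, mul_inv_cancel_left₀ (pow_ne_zero 2 hz0)]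
        exact hB z hz
  have hgd' : ∀ z : ℂ, z.im ∈ Icc (0 : ℝ) 1 → DifferentiableAt ℂ g z := fun z hz =>
    hgd.differentiableAt (hs.mem_nhds (hstrip hz))
  have hline : ∀ x : ℝ, k (x + (1 : ℝ) * I) / (x + (1 : ℝ) * I) ^ 2 = g (x + (1 : ℝ) * I) :=
    fun x => by
      rw [hgk _ fun h => by simpa using congrArg Complex.im h, div_eq_inv_mul]
  simp only [hline]
  have hone : (1 : ℝ) ∈ Icc (0 : ℝ) 1 := ⟨zero_le_one, le_rfl⟩
  refine ⟨integrable_horizontalLine (fun z hz => (hgd' z (hz ▸ hone)).continuousAt)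
    fun x => hC x 1 hone, ?_⟩
  rw [← integral_horizontalLine_eq zero_le_one hgd' hC]
  refine integral_eq_zero_of_odd fun x hx => ?_
  have hx' : (x : ℂ) ≠ 0 := Complex.ofReal_ne_zero.2 hx
  rw [Complex.ofReal_zero, zero_mul, add_zero, add_zero, Complex.ofReal_neg, hgk _ hx',
    hgk _ (neg_ne_zero.2 hx'), hodd, neg_sq, mul_neg]

lemma integral_horizontalLine_div_sq_of_odd {f : ℂ → ℂ} {f' : ℂ} {B : ℝ}
    (hd : Differentiable ℂ f) (hf' : HasDerivAt f f' 0) (hodd : ∀ z, f (-z) = -f z)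
    (hB : ∀ z : ℂ, z.im ∈ Icc (0 : ℝ) 1 → ‖f z‖ ≤ B) :
    ∫ x : ℝ, f (x + (1 : ℝ) * I) / (x + (1 : ℝ) * I) ^ 2 = -(I * π * f') := by
  set k : ℂ → ℂ := fun z => f z - f' * (4 * z / (4 + z ^ 2)) with hk
  have hkd : DifferentiableOn ℂ k {z | |z.im| < 2} := fun z hz =>
    (hd z).differentiableWithinAt.sub <| (DifferentiableAt.const_mul
      (DifferentiableAt.div (c := fun z => 4 * z) (d := fun z => 4 + z ^ 2)
        (by fun_prop) (by fun_prop) (four_add_sq_ne_zero hz)) _).differentiableWithinAt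
  have hkderiv : HasDerivAt k 0 0 := by
    have hq := ((hasDerivAt_id (0 : ℂ)).const_mul 4).div
      (((hasDerivAt_id (0 : ℂ)).pow 2).const_add 4) (by simp)
    convert! hf'.sub (hq.const_mul f') using 1
    norm_num
  have hkodd : ∀ z, k (-z) = -k z := fun z => by
    simp only [hk, hodd, neg_sq]
    ring
  have hkB : ∀ z : ℂ, z.im ∈ Icc (0 : ℝ) 1 → ‖k z‖ ≤ B + ‖f'‖ * 4 := fun z hz => by
    refine (norm_sub_le _ _).trans (add_le_add (hB z hz) ((norm_mul _ _).trans_le ?_))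
    exact mul_le_mul_of_nonneg_left (norm_four_mul_div_four_add_sq_le hz) (norm_nonneg _)
  obtain ⟨hkint, hkzero⟩ := integral_horizontalLine_div_sq_eq_zero_of_odd
    (isOpen_lt (by fun_prop) continuous_const) (fun z hz => abs_lt.2 ⟨by linarith [hz.1],
      by linarith [hz.2]⟩) hkd hkderiv.deriv hkodd hkB
  have hsplit : ∀ x : ℝ, f (x + (1 : ℝ) * I) / (x + (1 : ℝ) * I) ^ 2
      = k (x + (1 : ℝ) * I) / (x + (1 : ℝ) * I) ^ 2
        + f' * (4 / ((x + (1 : ℝ) * I) * (4 + (x + (1 : ℝ) * I) ^ 2))) := fun x => by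
    have hz : (x + (1 : ℝ) * I : ℂ) ≠ 0 := fun h => by simpa using congrArg Complex.im h
    have hz' : 4 + (x + (1 : ℝ) * I : ℂ) ^ 2 ≠ 0 := four_add_sq_ne_zero (by simp)
    simp only [hk]
    field_simp
    ring
  simp only [hsplit]
  rw [integral_add hkint (Integrable.const_mul ?_ _), hkzero, integral_const_mul,
    integral_four_div_mul_four_add_sq]
  · ring
  · refine Integrable.of_integral_ne_zero ?_
    rw [integral_four_div_mul_four_add_sq]
    simp [Real.pi_ne_zero]

end OddPole

section IdentityInitialDatum

variable {u : ℝ → ℝ} {x y t : ℝ} {z : ℂ}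

lemma uHat_id {w : ℂ} (hw : w ≠ 0) :
    uHat id w = Complex.exp w / w - (Complex.exp w - 1) / w ^ 2 := by
  have hzero : uHat (fun _ => 0) w = 0 := by
    simp only [uHat, Complex.ofReal_zero, mul_zero, intervalIntegral.integral_zero]
  have hid := mul_uHat (f := id) (f' := fun _ => 1) (by fun_prop) (by fun_prop)
    (fun x _ => hasDerivAt_id x) w
  have hone := mul_uHat (f := fun _ => 1) (f' := fun _ => 0) (by fun_prop) (by fun_prop)
    (fun x _ => hasDerivAt_const x 1) w
  rw [hzero] at hone
  simp only [id_eq, Complex.ofReal_one, Complex.ofReal_zero] at hid hone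
  field_simp
  linear_combination w * hid - hone

lemma coefPlus_id (hz : 0 < z.im) : coefPlus id z = -(1 / z ^ 2) := by
  have hz0 : z ≠ 0 := fun h => by simp [h] at hz
  have hIz : I * z ≠ 0 := mul_ne_zero Complex.I_ne_zero hz0
  have hexp := Complex.exp_ne_zero (I * z)
  rw [coefPlus, div_eq_iff (Delta_ne_zero hz), Delta, ← exp_mul_uHat_neg, uHat_id hIz,
    uHat_id (neg_ne_zero.2 hIz), Complex.exp_neg, neg_sq, mul_pow, Complex.I_sq]
  field_simp
  ring_nf
  simp only [Complex.I_sq]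
  ring

lemma coefMinus_id (hz : 0 < z.im) : coefMinus id z = -((1 - I * z) / z ^ 2) := by
  have hz0 : z ≠ 0 := fun h => by simp [h] at hz
  have hIz : I * z ≠ 0 := mul_ne_zero Complex.I_ne_zero hz0
  have hexp := Complex.exp_ne_zero (I * z)
  rw [coefMinus, div_eq_iff (Delta_ne_zero hz), Delta, ← exp_mul_uHat_neg, uHat_id hIz,
    uHat_id (neg_ne_zero.2 hIz), Complex.exp_neg, neg_sq, mul_pow, Complex.I_sq]
  field_simp
  ring_nf
  simp only [Complex.I_sq, Complex.I_pow_three]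
  ring

lemma norm_elem_strip_le (ht : 0 < t) (hz : z.im ∈ Icc (0 : ℝ) 1) (hy : |y| ≤ 1) :
    ‖elem y t z‖ ≤ Real.exp (1 + t) * (1 + 1 / t) / (1 + z.re ^ 2) := by
  have hre : (I * z * y - z ^ 2 * t).re ≤ 1 + t + -(t * z.re ^ 2) := by
    have heq : (I * z * y - z ^ 2 * t).re = -(z.im * y) - (z.re ^ 2 - z.im ^ 2) * t := by
      simp [pow_two]
    have himy : |z.im * y| ≤ 1 := by
      rw [abs_mul, abs_of_nonneg hz.1]
      exact mul_le_one₀ hz.2 (abs_nonneg y) hy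
    rw [heq]
    nlinarith [(abs_le.1 himy).1, mul_le_of_le_one_left ht.le (pow_le_one₀ (n := 2) hz.1 hz.2)]
  have hdecay : Real.exp (-(t * z.re ^ 2)) ≤ 1 / (1 + t * z.re ^ 2) := by
    rw [Real.exp_neg, ← one_div]
    exact one_div_le_one_div_of_le (by positivity)
      (by linarith [Real.add_one_le_exp (t * z.re ^ 2)])
  rw [elem, Complex.norm_exp]
  refine (Real.exp_le_exp.2 hre).trans ?_
  rw [Real.exp_add, mul_div_assoc]
  exact mul_le_mul_of_nonneg_left (hdecay.trans (one_div_one_add_mul_sq_le ht z.re))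
    (Real.exp_pos _).le

lemma exists_norm_uHat_neg_strip_le (hu : ContinuousOn u (Icc 0 1)) :
    ∃ K : ℝ, ∀ z : ℂ, z.im ∈ Icc (0 : ℝ) 1 → ‖uHat u (-(I * z))‖ ≤ K := by
  obtain ⟨K, hK⟩ := exists_norm_uHat_le (continuousOn_comp_one_sub hu)
  refine ⟨Real.exp 1 * K, fun z hz => ?_⟩
  have hexp : uHat u (-(I * z))
      = Complex.exp (-(I * z)) * uHat (fun x => u (1 - x)) (I * z) := by
    rw [← exp_mul_uHat_neg, ← mul_assoc, ← Complex.exp_add, neg_add_cancel, Complex.exp_zero,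
      one_mul]
  rw [hexp, norm_mul, norm_exp_neg_I_mul]
  refine mul_le_mul (Real.exp_le_exp.2 hz.2) (hK _ ?_) (norm_nonneg _) (Real.exp_pos _).le
  simpa only [Complex.I_mul_re, neg_nonpos] using hz.1

lemma integrable_and_integral_integrandReal_horizontalLine (hu : ContinuousOn u (Icc 0 1))
    (ht : 0 < t) (hx : |x| ≤ 1) :
    (Integrable fun a : ℝ => integrandReal u x t (a + (1 : ℝ) * I)) ∧
      ∫ a : ℝ, integrandReal u x t (a + (1 : ℝ) * I) = ∫ l : ℝ, integrandReal u x t l := by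
  obtain ⟨K, hK⟩ := exists_norm_uHat_neg_strip_le hu
  have hd : Differentiable ℂ (integrandReal u x t) := by
    have huHat := differentiable_uHat hu
    unfold integrandReal elem
    fun_prop
  have hle : ∀ a b : ℝ, b ∈ Icc (0 : ℝ) 1 → ‖integrandReal u x t (a + b * I)‖
      ≤ Real.exp (1 + t) * (1 + 1 / t) * K / (1 + a ^ 2) := fun a b hb => by
    have him : (a + b * I : ℂ).im ∈ Icc (0 : ℝ) 1 := by simpa using hb
    have helem := norm_elem_strip_le ht him hx
    have hre : (a + b * I : ℂ).re = a := by simp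
    rw [hre] at helem
    rw [integrandReal, norm_mul, mul_div_right_comm]
    exact mul_le_mul helem (hK _ him) (norm_nonneg _) ((norm_nonneg _).trans helem)
  refine ⟨integrable_horizontalLine (fun z _ => (hd z).continuousAt)
    fun a => hle a 1 ⟨zero_le_one, le_rfl⟩, ?_⟩
  rw [← integral_horizontalLine_eq zero_le_one (fun z _ => hd z) hle]
  simp only [Complex.ofReal_zero, zero_mul, add_zero]

/-- The odd entire function `f` for which the integrand of the representation with datum `x ↦ x`,
no flux, and `y = 1 - x`, moved to the line `Im z = 1`, is `f z / z²`. -/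
def identityNumerator (y t : ℝ) (z : ℂ) : ℂ :=
  elem (-y) t z * (1 + I * z) - elem y t z * (1 - I * z)

lemma identityNumerator_neg (y t : ℝ) (z : ℂ) :
    identityNumerator y t (-z) = -identityNumerator y t z := by
  simp only [identityNumerator, elem, Complex.ofReal_neg, neg_sq, mul_neg, neg_mul, neg_neg]
  ring

lemma differentiable_identityNumerator (y t : ℝ) : Differentiable ℂ (identityNumerator y t) := by
  unfold identityNumerator elem
  fun_prop

lemma hasDerivAt_elem_zero (y t : ℝ) : HasDerivAt (elem y t) (I * y) 0 := by
  have hexponent : HasDerivAt (fun z : ℂ => I * z * y - z ^ 2 * t) (I * y) 0 := by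
    convert! (((hasDerivAt_id (0 : ℂ)).const_mul I).mul_const (y : ℂ)).sub
      (((hasDerivAt_id (0 : ℂ)).pow 2).mul_const (t : ℂ)) using 1
    simp
  convert! hexponent.cexp using 1
  simp

lemma hasDerivAt_identityNumerator_zero (y t : ℝ) :
    HasDerivAt (identityNumerator y t) (2 * I * (1 - y)) 0 := by
  have hfactor : HasDerivAt (fun z : ℂ => I * z) I 0 := by
    simpa using (hasDerivAt_id (0 : ℂ)).const_mul I
  convert! ((hasDerivAt_elem_zero (-y) t).mul (hfactor.const_add 1)).sub
    ((hasDerivAt_elem_zero y t).mul (hfactor.const_sub 1)) using 1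
  simp only [Complex.ofReal_neg, mul_neg, mul_zero, add_zero, mul_one, elem, zero_mul, neg_zero,
    ne_eq, OfNat.ofNat_ne_zero, not_false_eq_true, zero_pow, sub_self, Complex.exp_zero, one_mul,
    sub_zero]
  ring

lemma exists_norm_identityNumerator_le (ht : 0 < t) (hy : |y| ≤ 1) :
    ∃ B : ℝ, ∀ z : ℂ, z.im ∈ Icc (0 : ℝ) 1 → ‖identityNumerator y t z‖ ≤ B := by
  set E := Real.exp (1 + t) * (1 + 1 / t)
  refine ⟨E * 3 + E * 3, fun z hz => ?_⟩
  have hlinear : 1 + ‖z‖ ≤ 3 * (1 + z.re ^ 2) := by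
    have himz : |z.im| ≤ 1 := abs_le.2 ⟨by linarith [hz.1], hz.2⟩
    have := Complex.norm_le_abs_re_add_abs_im z
    nlinarith [sq_abs z.re, sq_nonneg (|z.re| - 1)]
  have hterm : ∀ {a b : ℂ}, ‖a‖ ≤ E / (1 + z.re ^ 2) → ‖b‖ ≤ 1 + ‖z‖ → ‖a * b‖ ≤ E * 3 := by
    intro a b ha hb
    calc ‖a * b‖ ≤ E / (1 + z.re ^ 2) * (3 * (1 + z.re ^ 2)) := by
          rw [norm_mul]
          exact mul_le_mul ha (hb.trans hlinear) (norm_nonneg _) ((norm_nonneg _).trans ha)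
      _ = E * 3 := by field_simp
  exact (norm_sub_le _ _).trans (add_le_add
    (hterm (norm_elem_strip_le ht hz (by rwa [abs_neg])) (norm_one_add_I_mul_le z))
    (hterm (norm_elem_strip_le ht hz hy) (norm_one_sub_I_mul_le z)))

lemma integrand_id_eq_identityNumerator_div_sq (hz : 0 < z.im) (x t : ℝ) :
    integrandReal id x t z - boundaryKernel (coefPlus id) fluxPlus 0 x t z
        + boundaryKernel (coefMinus id) fluxMinus 0 (1 - x) t z
      = identityNumerator (1 - x) t z / z ^ 2 := by
  have hz0 : z ≠ 0 := fun h => by simp [h] at hz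
  have hneg : -(I * z) ≠ 0 := neg_ne_zero.2 (mul_ne_zero Complex.I_ne_zero hz0)
  have hexp : Complex.exp (I * z * (-(1 - x) : ℝ))
      = Complex.exp (I * z * x) * Complex.exp (-(I * z)) := by
    rw [← Complex.exp_add]
    congr 1
    push_cast
    ring
  rw [boundaryKernel_zero, boundaryKernel_zero, coefPlus_id hz, coefMinus_id hz, integrandReal,
    uHat_id hneg, identityNumerator]
  simp only [elem_eq_exp_mul_exp, hexp]
  rw [neg_sq, mul_pow, Complex.I_sq]
  field_simp
  ring_nf
  simp only [Complex.I_sq]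
  ring

lemma lineSolution_id_zero (ht : 0 < t) (hx : x ∈ Icc (0 : ℝ) 1) : lineSolution id 0 x t = x := by
  have habs : |x| ≤ 1 := abs_le.2 ⟨by linarith [hx.1], hx.2⟩
  have habs' : |1 - x| ≤ 1 := abs_le.2 ⟨by linarith [hx.2], by linarith [hx.1]⟩
  obtain ⟨hreal, hshift⟩ :=
    integrable_and_integral_integrandReal_horizontalLine continuousOn_id ht habs
  have hplus := integrable_boundaryKernel_zero (isContourMultiplier_coefPlus continuousOn_id)
    fluxPlus ht hx.1
  have hminus := integrable_boundaryKernel_zero (isContourMultiplier_coefMinus continuousOn_id)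
    fluxMinus ht (sub_nonneg.2 hx.2)
  obtain ⟨B, hB⟩ := exists_norm_identityNumerator_le ht habs'
  have htotal : (∫ l : ℝ, integrandReal id x t l) - boundaryIntegral (coefPlus id) fluxPlus 0 x t
      + boundaryIntegral (coefMinus id) fluxMinus 0 (1 - x) t
      = ∫ a : ℝ, identityNumerator (1 - x) t (a + (1 : ℝ) * I) / (a + (1 : ℝ) * I) ^ 2 := by
    rw [← hshift, boundaryIntegral, boundaryIntegral, ← integral_sub hreal hplus]
    refine (integral_add (hreal.sub hplus) hminus).symm.trans ?_
    exact integral_congr_ae (ae_of_all _ fun a =>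
      integrand_id_eq_identityNumerator_div_sq (by simp) x t)
  rw [lineSolution, htotal, integral_horizontalLine_div_sq_of_odd
    (differentiable_identityNumerator _ t) (hasDerivAt_identityNumerator_zero _ t)
    (identityNumerator_neg _ t) hB]
  have hpi : (π : ℂ) ≠ 0 := by exact_mod_cast Real.pi_ne_zero
  push_cast
  field_simp
  ring_nf
  simp only [Complex.I_sq]
  ring

end IdentityInitialDatum

section UniformLimit

variable {u j : ℝ → ℝ} {K : ℝ}

lemma tendstoUniformlyOn_lineSolution (hu : ContDiffOn ℝ 2 u (Icc 0 1)) (hu0 : u 0 = 0)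
    (hK : ∀ s ∈ Icc 0 1, |j s| ≤ K) (hj : IntervalIntegrable j volume 0 1) :
    TendstoUniformlyOn (fun t x => lineSolution u j x t) (fun x => (u x : ℂ)) (𝓝[>] 0)
      (Icc 0 1) := by
  set w : ℝ → ℝ := u - u 1 • id with hw
  have hwC2 : ContDiffOn ℝ 2 w (Icc 0 1) := hu.sub (contDiff_id.const_smul (u 1)).contDiffOn
  have hdecomp : u = w + u 1 • id := (sub_add_cancel _ _).symm
  obtain ⟨C, hC⟩ := exists_norm_lineSolution_sub_zero_le hu.continuousOn hK hj
  obtain ⟨A, B, hAB⟩ := exists_norm_lineSolution_zero_sub_le hwC2 (by simp [hw, hu0])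
    (by simp [hw])
  have hbound : Tendsto (fun t => C * √t + (heatDefect 0 A t + 2 * heatDefect 1 B t)) (𝓝[>] 0)
      (𝓝 0) := by
    have hsqrt : Tendsto Real.sqrt (𝓝[>] 0) (𝓝 0) := by
      simpa using (Real.continuous_sqrt.tendsto 0).mono_left nhdsWithin_le_nhds
    simpa using (hsqrt.const_mul C).add
      ((tendsto_heatDefect 0 A).add ((tendsto_heatDefect 1 B).const_mul 2))
  rw [Metric.tendstoUniformlyOn_iff]
  intro ε hε
  filter_upwards [hbound.eventually (gt_mem_nhds hε), Ioc_mem_nhdsGT one_pos] with t hsmall ht x hx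
  have hlinear : lineSolution u 0 x t - u x = lineSolution w 0 x t - w x := by
    have hsplit := lineSolution_zero_add_smul hwC2.continuousOn continuousOn_id (u 1) ht.1 hx
    rw [← hdecomp, lineSolution_id_zero ht.1 hx] at hsplit
    rw [hsplit, hw]
    simp only [Pi.sub_apply, Pi.smul_apply, id_eq, smul_eq_mul, Complex.ofReal_sub,
      Complex.ofReal_mul]
    ring
  rw [dist_comm, dist_eq_norm]
  refine lt_of_le_of_lt ?_ hsmall
  calc ‖lineSolution u j x t - u x‖
      ≤ ‖lineSolution u j x t - lineSolution u 0 x t‖ + ‖lineSolution u 0 x t - u x‖ :=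
        norm_sub_le_norm_sub_add_norm_sub _ _ _
    _ ≤ C * √t + (heatDefect 0 A t + 2 * heatDefect 1 B t) :=
        add_le_add (hC t ht x hx) (hlinear ▸ hAB t ht x hx)

end UniformLimit

end

end SingleParticle

theorem mainTheorem5_general (u₀ j : ℝ → ℝ)
    (hj : ∀ T, 0 < T → IntervalIntegrable j volume 0 T)
    (hj' : ∀ T, 0 < T → ∃ K, ∀ s ∈ Icc 0 T, |j s| ≤ K)
    (hu₀ : ContDiffOn ℝ 2 u₀ (Icc 0 1)) (hu₀0 : u₀ 0 = 0) :
    ∃ u : ℝ → ℝ → ℂ, SingleParticle.IsRepresentedSolution u₀ j u ∧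
      TendstoUniformlyOn (fun t x => u x t) (fun x => (u₀ x : ℂ)) (𝓝[>] 0) (Icc 0 1) := by
  obtain ⟨K, hK⟩ := hj' 1 one_pos
  exact ⟨SingleParticle.lineSolution u₀ j,
    SingleParticle.isRepresentedSolution_lineSolution hu₀.continuousOn hj hj',
    SingleParticle.tendstoUniformlyOn_lineSolution hu₀ hu₀0 hK (hj 1 one_pos)⟩

/-- The integral representation defines a function `u` on `[0, 1] × (0, ∞)`, and `u(·, t) → u₀`
uniformly on the closed interval `[0, 1]` as `t ↓ 0`. -/
theorem mainTheorem5 (u₀ j : ℝ → ℝ)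
    (hj : SingleParticle.HasPiecewiseContinuousDeriv j)
    (hu₀ : ContDiffOn ℝ 2 u₀ (Set.Icc 0 1)) (hu₀0 : u₀ 0 = 0) :
    ∃ u : ℝ → ℝ → ℂ, SingleParticle.IsRepresentedSolution u₀ j u ∧
      TendstoUniformlyOn (fun t x => u x t) (fun x => (u₀ x : ℂ))
        (nhdsWithin 0 (Set.Ioi 0)) (Set.Icc 0 1) :=
  mainTheorem5_general u₀ j (fun _ hT => hj.intervalIntegrable hT) (fun _ _ => hj.exists_abs_le)
    hu₀ hu₀0
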